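/- Let $m$ be Lebesgue measure on $(\mathbb R,\mathcal B(\mathbb R))$ and let $\mathfrak G$ be the Polish group of invertible measure preserving transformations of $(\mathbb R,\mathcal B(\mathbb R),m)$, identified when they agree $m$-a.e., with the weak topology: $T_i\to T$ iff $m(T_i^{-1}A\,\triangle\,T^{-1}A)\to 0$ for every Borel set $A$ with $m(A)<\infty$. For a Borel set $A$ let $\varphi_A(x):=\min\{n\ge 1: T^nx\in A\}$ be its first return time. A conservative, ergodic $T\in\mathfrak G$ is called log lower bounded (LLB) if there is a Borel set $A$ with $0<m(A)<\infty$ and $\int_A\log\varphi_A\,dm<\infty$. Proposition. The set of LLB transformations is meagre in $\mathfrak G$. Moreover, the set $$\Big\{T\in\mathfrak G:\ \exists\, n_k\to\infty \text{ such that } \frac{S_{n_k}(f)}{\log n_k}\to 0 \text{ a.e. for every } f\in L^1(m)\Big\},\qquad S_n(f):=\sum_{j=0}^{n-1}f\circ T^j,$$ is a dense $G_\delta$ subset of $\mathfrak G$ and contains no LLB transformation. -/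

import Mathlib

open MeasureTheory Filter Topology
open scoped ENNReal

/-! ### Return times and log lower boundedness -/

section Dynamics

variable {X : Type*}

/-- The first return time `φ_A(x) = min {n ≥ 1 : Tⁿ x ∈ A}`, with value `∞` if the orbit of `x`
never enters `A` at a positive time. -/
noncomputable def firstReturnTime (T : X → X) (A : Set X) (x : X) : ℝ≥0∞ :=
  ⨅ (n : ℕ) (_ : 1 ≤ n ∧ T^[n] x ∈ A), (n : ℝ≥0∞)

variable [MeasurableSpace X]

/-- The class `F_{log,T}` of the measurable sets `A` with `0 < m(A) < ∞` and
`∫_A log φ_A dm < ∞`. As `φ_A ≥ 1`, the extended-real number `log φ_A` (with `log ∞ = ∞`) is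
nonnegative, so passing to `ℝ≥0∞` loses nothing. -/
def logReturnSets (T : X → X) (m : Measure X) : Set (Set X) :=
  {A | MeasurableSet A ∧ 0 < m A ∧ m A < ∞ ∧
    ∫⁻ x in A, (ENNReal.log (firstReturnTime T A x)).toENNReal ∂m < ∞}

/-- A log lower bounded (LLB) transformation: a conservative, ergodic, measure preserving
transformation `T` with `F_{log,T} ≠ ∅`. (Mathlib's `Ergodic` includes measure preservation.) -/
structure LogLowerBounded (T : X → X) (m : Measure X) : Prop where
  conservative : Conservative T m
  ergodic : Ergodic T m
  nonempty : (logReturnSets T m).Nonempty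

/-- There is one sequence `n_k → ∞` such that, for every `f ∈ L¹(m)`,
`S_{n_k}(f) / log n_k → 0` almost everywhere, where `S_n(f) = ∑_{j < n} f ∘ T^j`. -/
def HasLogNegligibleSums (T : X → X) (m : Measure X) : Prop :=
  ∃ n : ℕ → ℕ, Tendsto n atTop atTop ∧ ∀ f : X → ℝ, Integrable f m →
    ∀ᵐ x ∂m, Tendsto (fun k => birkhoffSum T f (n k) x / Real.log (n k)) atTop (𝓝 0)

/-! Both properties depend only on the almost everywhere class of the transformation. -/

theorem iterate_ae_eq {T S : X → X} {m : Measure X} (hT : Measure.QuasiMeasurePreserving T m m)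
    (h : T =ᵐ[m] S) : ∀ᵐ x ∂m, ∀ n : ℕ, T^[n] x = S^[n] x := by
  have h1 : ∀ᵐ x ∂m, ∀ n : ℕ, T (T^[n] x) = S (T^[n] x) :=
    ae_all_iff.2 fun n => (hT.iterate n).ae h
  filter_upwards [h1] with x hx n
  induction n with
  | zero => rfl
  | succ n ih => rw [Function.iterate_succ_apply', Function.iterate_succ_apply', hx n, ih]

theorem LogLowerBounded.congr {T S : X → X} {m : Measure X} (hT : LogLowerBounded T m)
    (hS : MeasurePreserving S m m) (h : T =ᵐ[m] S) : LogLowerBounded S m := by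
  have hit := iterate_ae_eq hT.conservative.toQuasiMeasurePreserving h
  refine ⟨⟨hS.quasiMeasurePreserving, fun s hs h0 => ?_⟩, ⟨hS, ⟨fun s hs hss => ?_⟩⟩, ?_⟩
  · have hnull : (s ∩ {x | ∀ n : ℕ, T^[n] x = S^[n] x} : Set X) =ᵐ[m] s := by
      filter_upwards [hit] with x hx
      exact propext ⟨fun hx' => hx'.1, fun hx' => ⟨hx', hx⟩⟩
    obtain ⟨x, hx, k, hk, hkx⟩ := hT.conservative.exists_mem_iterate_mem
      (hs.nullMeasurableSet.congr hnull.symm) (by rwa [measure_congr hnull])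
    exact ⟨x, hx.1, k, hk, hx.2 k ▸ hkx.1⟩
  · refine hT.ergodic.quasiErgodic.aeconst_set₀ hs.nullMeasurableSet ?_
    filter_upwards [h] with x hx
    change (T x ∈ s) = (x ∈ s)
    rw [hx]
    exact congrArg (x ∈ ·) hss
  · obtain ⟨A, hA, h0, h1, h2⟩ := hT.nonempty
    refine ⟨A, hA, h0, h1, lt_of_eq_of_lt (lintegral_congr_ae (ae_restrict_of_ae ?_)) h2⟩
    filter_upwards [hit] with x hx
    simp only [firstReturnTime, hx]

theorem HasLogNegligibleSums.congr {T S : X → X} {m : Measure X} (hT : HasLogNegligibleSums T m)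
    (hTm : MeasurePreserving T m m) (h : T =ᵐ[m] S) : HasLogNegligibleSums S m := by
  obtain ⟨n, hn, H⟩ := hT
  refine ⟨n, hn, fun f hf => ?_⟩
  filter_upwards [H f hf, iterate_ae_eq hTm.quasiMeasurePreserving h] with x hx hit
  simpa only [birkhoffSum, hit] using hx

end Dynamics

/-! ### The group of invertible measure preserving transformations -/

section Group

variable {X : Type*} [MeasurableSpace X]

/-- Invertible bimeasurable transformations of `X` that preserve the measure `m`. -/
structure MPAut (m : Measure X) where
  toEquiv : X ≃ᵐ X
  measurePreserving : MeasurePreserving toEquiv m m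

namespace MPAut

variable {m : Measure X}

instance : CoeFun (MPAut m) fun _ => X → X := ⟨fun T => T.toEquiv⟩

@[ext] theorem ext {T S : MPAut m} (h : ∀ x, T x = S x) : T = S := by
  cases T
  cases S
  congr
  exact MeasurableEquiv.ext (funext h)

/-- The group law is composition: `(T * S) x = T (S x)`. -/
instance : Group (MPAut m) where
  mul T S := ⟨S.toEquiv.trans T.toEquiv, T.measurePreserving.comp S.measurePreserving⟩
  one := ⟨MeasurableEquiv.refl X, MeasurePreserving.id m⟩
  inv T := ⟨T.toEquiv.symm, T.measurePreserving.symm T.toEquiv⟩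
  mul_assoc _ _ _ := rfl
  one_mul _ := rfl
  mul_one _ := rfl
  inv_mul_cancel T := ext fun x => T.toEquiv.symm_apply_apply x

theorem mul_apply (T S : MPAut m) (x : X) : (T * S) x = T (S x) := rfl

theorem one_apply (x : X) : (1 : MPAut m) x = x := rfl

theorem apply_inv_apply (T : MPAut m) (x : X) : T (T⁻¹ x) = x := T.toEquiv.apply_symm_apply x

theorem inv_apply_apply (T : MPAut m) (x : X) : T⁻¹ (T x) = x := T.toEquiv.symm_apply_apply x

/-- The preimage `T⁻¹ A`, as a point of the space of measurable sets with `d(A, B) = m(A ∆ B)`. -/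
def preimage (T : MPAut m) (A : MeasuredSets m) : MeasuredSets m :=
  ⟨T ⁻¹' (A : Set X), T.toEquiv.measurable A.2⟩

/-- The weak topology: the coarsest one for which `T ↦ T⁻¹ A` is continuous, with respect to
`d(A, B) = m(A ∆ B)`, for every measurable `A` of finite measure. Thus `T_i → T` if and only if
`m(T_i⁻¹ A ∆ T⁻¹ A) → 0` for all such `A`. -/
noncomputable instance : TopologicalSpace (MPAut m) :=
  ⨅ (A : MeasuredSets m) (_ : m (A : Set X) < ∞),
    TopologicalSpace.induced (fun T : MPAut m => T.preimage A) inferInstance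

variable (m) in
/-- The normal subgroup of the transformations that are almost everywhere the identity. -/
def aeTrivial : Subgroup (MPAut m) where
  carrier := {T | ∀ᵐ x ∂m, T x = x}
  one_mem' := ae_of_all m one_apply
  mul_mem' {T S} hT hS := by
    change ∀ᵐ x ∂m, (T * S) x = x
    filter_upwards [hT, hS] with x hx hy
    rw [mul_apply, hy, hx]
  inv_mem' {T} hT := by
    change ∀ᵐ x ∂m, T⁻¹ x = x
    filter_upwards [hT] with x hx
    conv_lhs => rw [← hx]
    exact inv_apply_apply T x

instance : (aeTrivial m).Normal where
  conj_mem T hT S := by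
    have h : ∀ᵐ x ∂m, T (S⁻¹ x) = S⁻¹ x :=
      (S⁻¹).measurePreserving.quasiMeasurePreserving.ae hT
    change ∀ᵐ x ∂m, (S * T * S⁻¹) x = x
    filter_upwards [h] with x hx
    rw [mul_apply, mul_apply, hx, apply_inv_apply]

theorem ae_eq_of_leftRel {T S : MPAut m} (h : QuotientGroup.leftRel (aeTrivial m) T S) :
    (T : X → X) =ᵐ[m] S := by
  have h' : ∀ᵐ x ∂m, (T⁻¹ * S) x = x := QuotientGroup.leftRel_apply.1 h
  filter_upwards [h'] with x hx
  conv_lhs => rw [← hx]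
  exact apply_inv_apply T (S x)

end MPAut

/-- The group of invertible measure preserving transformations of `(X, m)`, two of them being
identified when they agree almost everywhere. It carries the quotient group structure and the
(quotient of the) weak topology. -/
abbrev MPGroup (m : Measure X) : Type _ := MPAut m ⧸ MPAut.aeTrivial m

/-- An element of the group is LLB if its representatives are; the choice of the
representative does not matter. -/
def MPGroup.IsLLB {m : Measure X} (T : MPGroup m) : Prop :=
  Quotient.liftOn T (fun S : MPAut m => LogLowerBounded S m) fun S S' h =>
    have hS := MPAut.ae_eq_of_leftRel h
    propext ⟨fun H => H.congr S'.measurePreserving hS,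
      fun H => H.congr S.measurePreserving hS.symm⟩

/-- An element of the group has the property that `S_{n_k}(f) / log n_k → 0` almost everywhere
for all `f ∈ L¹`, along one sequence `n_k → ∞`; the choice of the representative does not
matter. -/
def MPGroup.HasLogNegligibleSums {m : Measure X} (T : MPGroup m) : Prop :=
  Quotient.liftOn T (fun S : MPAut m => _root_.HasLogNegligibleSums S m) fun S S' h =>
    have hS := MPAut.ae_eq_of_leftRel h
    propext ⟨fun H => H.congr S.measurePreserving hS,
      fun H => H.congr S'.measurePreserving hS.symm⟩

end Group

/-! Fix one integrable `f₀` with `0 < f₀ ≤ 1`. By Hopf's inequality every `|S_n(f)|` is at most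
`C(x) S_n(f₀)` a.e., so `f₀` alone decides the property. Along fast subsequences it becomes a
condition on the numbers `∫ min(1, S_n(f₀)/log n) f₀ dm` (`hasLogNegligibleSums_iff`). These depend
continuously on `T` for the weak topology, whence a `G_δ`.

Density comes from dissipative maps: permutations of the cells of a fine grid without periodic
cells. Each cell wanders, so `S_n(f)` converges a.e. A given `T` is imitated on finitely many cells
by a partial injection; cutting each cell into `q` pieces and sending piece `r` to piece `r + 1` of
the target cell removes all cycles at the cost of a proportion `1/q`.

For the exclusion of LLB maps let `I = ∫_A log φ_A dm`. The points of `A` with at most `L` visits to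
`A` in `L * K + 1` steps have measure at most `L m(A ∩ {φ_A ≥ K}) ≤ L I / log K`
(`measure_rareVisits_le`). For `K ≈ √N` and `L ≈ ε log N` this is `O(ε I)`. So for small `ε` more
than half of `A` visits `A` at least `ε log N` times before time `N`, which prevents `S_N(1_A)/log N
→ 0` a.e. along any sequence. Meagreness follows, a dense `G_δ` being residual. -/

/-! ### The maximal ergodic inequality and ratios of Birkhoff sums -/

section MaximalErgodic

variable {X : Type*}

/-- The maximum of `0` and the Birkhoff sums of `g` of order at most `N`. -/
noncomputable def birkhoffMax (T : X → X) (g : X → ℝ) : ℕ → X → ℝ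
  | 0, _ => 0
  | N + 1, x => max 0 (g x + birkhoffMax T g N (T x))

theorem birkhoffMax_nonneg (T : X → X) (g : X → ℝ) (N : ℕ) (x : X) : 0 ≤ birkhoffMax T g N x := by
  cases N with
  | zero => exact le_rfl
  | succ N => exact le_max_left _ _

theorem birkhoffMax_le_succ (T : X → X) (g : X → ℝ) (N : ℕ) (x : X) :
    birkhoffMax T g N x ≤ birkhoffMax T g (N + 1) x := by
  induction N generalizing x with
  | zero => exact birkhoffMax_nonneg T g 1 x
  | succ N ih => exact max_le_max le_rfl (add_le_add le_rfl (ih (T x)))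

theorem birkhoffSum_le_birkhoffMax (T : X → X) (g : X → ℝ) (N : ℕ) (x : X) :
    birkhoffSum T g N x ≤ birkhoffMax T g N x := by
  induction N generalizing x with
  | zero => simp [birkhoffMax]
  | succ N ih =>
    rw [birkhoffSum_succ']
    exact le_max_of_le_right (add_le_add le_rfl (ih (T x)))

theorem birkhoffSum_div_log_nonneg {T : X → X} {f : X → ℝ} (hf : ∀ x, 0 ≤ f x) (n : ℕ) (x : X) :
    0 ≤ birkhoffSum T f n x / Real.log n :=
  div_nonneg (Finset.sum_nonneg fun _ _ => hf _) (Real.log_natCast_nonneg n)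

variable [MeasurableSpace X] {m : Measure X} {T : X → X}

theorem measurable_birkhoffSum (hT : Measurable T) {f : X → ℝ} (hf : Measurable f) (n : ℕ) :
    Measurable (birkhoffSum T f n) := by
  have h : birkhoffSum T f n = fun x => ∑ j ∈ Finset.range n, f (T^[j] x) := rfl
  rw [h]
  exact Finset.measurable_fun_sum _ fun j _ => hf.comp (hT.iterate j)

theorem measurable_birkhoffMax (hT : Measurable T) {g : X → ℝ} (hg : Measurable g) (N : ℕ) :
    Measurable (birkhoffMax T g N) := by
  induction N with
  | zero => exact measurable_const
  | succ N ih => exact measurable_const.max (hg.add (ih.comp hT))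

theorem integrable_birkhoffMax (hT : MeasurePreserving T m m) {g : X → ℝ} (hg : Integrable g m)
    (N : ℕ) : Integrable (birkhoffMax T g N) m := by
  induction N with
  | zero => exact integrable_zero _ _ _
  | succ N ih =>
    exact (integrable_zero X ℝ m).sup (hg.add (hT.integrable_comp_of_integrable ih))

/-- Hopf's maximal ergodic inequality. -/
theorem setIntegral_birkhoffMax_pos_nonneg (hT : MeasurePreserving T m m) {g : X → ℝ}
    (hg : Integrable g m) (hgm : Measurable g) (N : ℕ) :
    0 ≤ ∫ x in {x | 0 < birkhoffMax T g N x}, g x ∂m := by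
  have hE : MeasurableSet {x | 0 < birkhoffMax T g N x} :=
    measurableSet_lt measurable_const (measurable_birkhoffMax hT.measurable hgm N)
  have hM := integrable_birkhoffMax hT hg N
  have hMT := hT.integrable_comp_of_integrable hM
  rw [← integral_indicator hE]
  have h0 : ∫ x, (birkhoffMax T g N x - birkhoffMax T g N (T x)) ∂m = 0 := by
    have h1 : ∫ x, birkhoffMax T g N (T x) ∂m = ∫ x, birkhoffMax T g N x ∂m := by
      have h2 := integral_map (μ := m) hT.aemeasurable (f := birkhoffMax T g N)
        (by rw [hT.map_eq]; exact hM.aestronglyMeasurable)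
      rw [hT.map_eq] at h2
      exact h2.symm
    rw [integral_sub hM (by exact hMT), h1, sub_self]
  -- Pointwise, `M_N - M_N ∘ T ≤ 1_E g`: on `E` the positive maximum is `g + M_{N-1} ∘ T ≤ g + M_N ∘
  -- T`, and off `E` it vanishes. The left side has integral zero.
  refine h0.symm.le.trans (integral_mono (hM.sub hMT) (hg.indicator hE) fun x => ?_)
  by_cases hx : 0 < birkhoffMax T g N x
  · rw [Set.indicator_of_mem (show x ∈ {x | 0 < birkhoffMax T g N x} from hx)]
    cases N with
    | zero => exact absurd hx (lt_irrefl _)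
    | succ N =>
      have h2 := birkhoffMax_le_succ T g N (T x)
      have h3 : birkhoffMax T g (N + 1) x = g x + birkhoffMax T g N (T x) := by
        rcases lt_max_iff.1 (show (0 : ℝ) < max 0 (g x + birkhoffMax T g N (T x)) from hx) with h | h
        · exact absurd h (lt_irrefl _)
        · exact max_eq_right h.le
      simp only
      linarith
  · rw [Set.indicator_of_notMem (show x ∉ {x | 0 < birkhoffMax T g N x} from hx)]
    have := birkhoffMax_nonneg T g N (T x)
    simp only
    linarith [not_lt.1 hx]

/-- Hopf's inequality for `f - (c + 1) f₀` shows that the points where some `S_n(f)` exceeds `(c +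
1) S_n(f₀)` have mass at most `∫ f / (c + 1)` for the measure `f₀ m`. Letting `c → ∞`, the points
that are bad for every `c` form a null set, for `m` too because `f₀ > 0`. -/
theorem ae_exists_birkhoffSum_le_mul (hT : MeasurePreserving T m m) {f f₀ : X → ℝ}
    (hf : Integrable f m) (hfm : Measurable f) (hf_nonneg : ∀ x, 0 ≤ f x)
    (hf₀ : Integrable f₀ m) (hfm₀ : Measurable f₀) (hpos : ∀ x, 0 < f₀ x) :
    ∀ᵐ x ∂m, ∃ C : ℝ, ∀ n, birkhoffSum T f n x ≤ C * birkhoffSum T f₀ n x := by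
  set ν : Measure X := m.withDensity fun x => ENNReal.ofReal (f₀ x) with hν
  set g : ℕ → X → ℝ := fun c x => f x - (c + 1 : ℝ) * f₀ x with hgdef
  have hg : ∀ c, Integrable (g c) m := fun c => hf.sub (hf₀.const_mul _)
  have hgm : ∀ c, Measurable (g c) := fun c => hfm.sub (hfm₀.const_mul _)
  set E : ℕ → ℕ → Set X := fun c N => {x | 0 < birkhoffMax T (g c) N x} with hEdef
  have hE : ∀ c N, MeasurableSet (E c N) := fun c N =>
    measurableSet_lt measurable_const (measurable_birkhoffMax hT.measurable (hgm c) N)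
  have hbound : ∀ c N, ν (E c N) ≤ ENNReal.ofReal ((∫ x, f x ∂m) / (c + 1 : ℝ)) := by
    intro c N
    rw [hν, withDensity_apply _ (hE c N), ← ofReal_integral_eq_lintegral_ofReal
      hf₀.integrableOn (ae_of_all _ fun x => (hpos x).le)]
    refine ENNReal.ofReal_le_ofReal ?_
    have h1 := setIntegral_birkhoffMax_pos_nonneg hT (hg c) (hgm c) N
    have h2 : ∫ x in E c N, g c x ∂m
        = ∫ x in E c N, f x ∂m - (c + 1 : ℝ) * ∫ x in E c N, f₀ x ∂m := by
      rw [hgdef, integral_sub hf.integrableOn (hf₀.const_mul _).integrableOn,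
        integral_const_mul]
    have h3 : ∫ x in E c N, f x ∂m ≤ ∫ x, f x ∂m :=
      setIntegral_le_integral hf (ae_of_all _ hf_nonneg)
    rw [le_div_iff₀ (by positivity)]
    change 0 ≤ ∫ x in E c N, g c x ∂m at h1
    linarith
  have hunion : ∀ c, ν (⋃ N, E c N) ≤ ENNReal.ofReal ((∫ x, f x ∂m) / (c + 1 : ℝ)) := by
    intro c
    have hmono : Monotone (E c) := monotone_nat_of_le_succ fun N x hx =>
      lt_of_lt_of_le hx (birkhoffMax_le_succ T (g c) N x)
    rw [hmono.measure_iUnion]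
    exact iSup_le (hbound c)
  have hnull : ν (⋂ c, ⋃ N, E c N) = 0 := by
    refine le_antisymm (ge_of_tendsto' (f := fun c : ℕ =>
      ENNReal.ofReal ((∫ x, f x ∂m) / (c + 1 : ℝ))) (x := atTop) ?_ fun c =>
        (measure_mono (Set.iInter_subset _ c)).trans (hunion c)) bot_le
    rw [← ENNReal.ofReal_zero]
    refine ENNReal.tendsto_ofReal ?_
    exact tendsto_const_nhds.div_atTop (tendsto_atTop_add_const_right _ _
      tendsto_natCast_atTop_atTop)
  have habs : m ≪ ν := withDensity_absolutelyContinuous' (by fun_prop)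
    (ae_of_all _ fun x => by simpa using hpos x)
  have hnull' := habs hnull
  filter_upwards [measure_eq_zero_iff_ae_notMem.1 hnull'] with x hx
  simp only [Set.mem_iInter, not_forall, Set.mem_iUnion, not_exists] at hx
  obtain ⟨c, hc⟩ := hx
  refine ⟨c + 1, fun n => ?_⟩
  have h1 : birkhoffSum T (g c) n x ≤ 0 :=
    (birkhoffSum_le_birkhoffMax T (g c) n x).trans (not_lt.1 (hc n))
  have h2 : birkhoffSum T (g c) n x
      = birkhoffSum T f n x - (c + 1 : ℝ) * birkhoffSum T f₀ n x := by
    simp only [birkhoffSum, hgdef, Finset.sum_sub_distrib, Finset.mul_sum]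
  linarith

theorem ae_exists_abs_birkhoffSum_le_mul (hT : MeasurePreserving T m m) {f f₀ : X → ℝ}
    (hf : Integrable f m) (hf₀ : Integrable f₀ m) (hfm₀ : Measurable f₀) (hpos : ∀ x, 0 < f₀ x) :
    ∀ᵐ x ∂m, ∃ C : ℝ, ∀ n, |birkhoffSum T f n x| ≤ C * birkhoffSum T f₀ n x := by
  obtain ⟨f', hf'm, hff'⟩ := hf.aestronglyMeasurable
  have h1 := ae_exists_birkhoffSum_le_mul hT (hf.congr hff').abs
    (hf'm.measurable.abs) (fun x => abs_nonneg _) hf₀ hfm₀ hpos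
  have h2 : ∀ᵐ x ∂m, ∀ n : ℕ, f (T^[n] x) = f' (T^[n] x) :=
    ae_all_iff.2 fun n => (hT.iterate n).quasiMeasurePreserving.ae hff'
  filter_upwards [h1, h2] with x ⟨C, hC⟩ hx
  refine ⟨C, fun n => le_trans ?_ (hC n)⟩
  simp only [birkhoffSum, hx]
  exact Finset.abs_sum_le_sum_abs _ _

end MaximalErgodic

/-! ### A countable criterion for negligible Birkhoff sums -/

section Criterion

variable {X : Type*} [MeasurableSpace X] {m : Measure X} {T : X → X}

/-- The integral, against the density `f`, of the truncation at `1` of `S_n(f) / log n`. -/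
noncomputable def truncatedLogAverage (m : Measure X) (T : X → X) (f : X → ℝ) (n : ℕ) : ℝ :=
  ∫ x, min 1 (birkhoffSum T f n x / Real.log n) * f x ∂m

theorem integrable_truncatedLog (hT : MeasurePreserving T m m) {f : X → ℝ}
    (hf : Integrable f m) (hfm : Measurable f) (hpos : ∀ x, 0 ≤ f x) (n : ℕ) :
    Integrable (fun x => min 1 (birkhoffSum T f n x / Real.log n) * f x) m := by
  refine hf.mono' ?_ (ae_of_all _ fun x => ?_)
  · have := measurable_birkhoffSum hT.measurable hfm n
    exact Measurable.aestronglyMeasurable (by fun_prop)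
  · have h0 := birkhoffSum_div_log_nonneg (T := T) hpos n x
    have h1 := hpos x
    rw [Real.norm_of_nonneg (mul_nonneg (le_min zero_le_one h0) h1)]
    exact mul_le_of_le_one_left h1 (min_le_left _ _)

/-- Truncated averages measure convergence to zero in measure for the finite measure `f₀ m`, and
convergence in measure yields a.e. convergence along a subsequence. The bound `i + 2 ≤ n` forces `n
→ ∞` and keeps `log n` positive. -/
theorem hasLogNegligibleSums_iff (hT : MeasurePreserving T m m) {f₀ : X → ℝ}
    (hf₀ : Integrable f₀ m) (hfm₀ : Measurable f₀) (hpos : ∀ x, 0 < f₀ x) :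
    HasLogNegligibleSums T m ↔
      ∀ i : ℕ, ∃ n, i + 2 ≤ n ∧ truncatedLogAverage m T f₀ n < (1 / 2) ^ i := by
  constructor
  · rintro ⟨n, hn, H⟩ i
    have hlim : Tendsto (fun k => truncatedLogAverage m T f₀ (n k)) atTop (𝓝 0) := by
      have h := tendsto_integral_of_dominated_convergence (μ := m)
        (F := fun k x => min 1 (birkhoffSum T f₀ (n k) x / Real.log (n k)) * f₀ x)
        (f := fun _ => (0 : ℝ)) (bound := f₀)
        (fun k => (integrable_truncatedLog hT hf₀ hfm₀ (fun x => (hpos x).le)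
          (n k)).aestronglyMeasurable) hf₀
        (fun k => ae_of_all _ fun x => by
          have h0 := birkhoffSum_div_log_nonneg (T := T) (fun x => (hpos x).le) (n k) x
          rw [Real.norm_of_nonneg (mul_nonneg (le_min zero_le_one h0) (hpos x).le)]
          exact mul_le_of_le_one_left (hpos x).le (min_le_left _ _))
        (by
          filter_upwards [H f₀ hf₀] with x hx
          simpa using (tendsto_const_nhds (x := (1 : ℝ)).min hx).mul_const (f₀ x))
      simpa [truncatedLogAverage] using h
    obtain ⟨k, h1, h2⟩ := ((hlim.eventually_lt_const (show (0 : ℝ) < (1 / 2) ^ i by positivity)).and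
      (hn.eventually_ge_atTop (i + 2))).exists
    exact ⟨n k, h2, h1⟩
  · intro H
    choose n hn hlt using H
    have hnt : Tendsto n atTop atTop :=
      tendsto_atTop_mono (fun i => (Nat.le_add_right i 2).trans (hn i)) tendsto_id
    set F : ℕ → X → ℝ := fun i x => min 1 (birkhoffSum T f₀ (n i) x / Real.log (n i)) * f₀ x
      with hF
    have hFint : ∀ i, Integrable (F i) m := fun i =>
      integrable_truncatedLog hT hf₀ hfm₀ (fun x => (hpos x).le) (n i)
    have hu : ∀ i x, 0 ≤ birkhoffSum T f₀ (n i) x / Real.log (n i) := fun i x =>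
      birkhoffSum_div_log_nonneg (fun x => (hpos x).le) (n i) x
    have hF0 : ∀ i x, 0 ≤ F i x := fun i x => mul_nonneg (le_min zero_le_one (hu i x)) (hpos x).le
    -- The bounds `2^{-i}` are summable, so the series of the `F i` has finite integral and its
    -- terms tend to zero a.e.
    have hsum : ∫⁻ x, ∑' i, ENNReal.ofReal (F i x) ∂m ≠ ∞ := by
      rw [lintegral_tsum fun i => (hFint i).aemeasurable.ennreal_ofReal]
      have hle : ∀ i, ∫⁻ x, ENNReal.ofReal (F i x) ∂m ≤ ENNReal.ofReal ((1 / 2) ^ i) := fun i => by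
        rw [← ofReal_integral_eq_lintegral_ofReal (hFint i) (ae_of_all _ (hF0 i))]
        exact ENNReal.ofReal_le_ofReal (hlt i).le
      refine ne_top_of_le_ne_top ?_ (ENNReal.tsum_le_tsum hle)
      exact (summable_geometric_of_lt_one (by norm_num) (by norm_num)).tsum_ofReal_ne_top
    have hconv : ∀ᵐ x ∂m, Tendsto (fun i => birkhoffSum T f₀ (n i) x / Real.log (n i)) atTop
        (𝓝 0) := by
      filter_upwards [ae_lt_top' (AEMeasurable.tsum
        fun i => (hFint i).aemeasurable.ennreal_ofReal) hsum] with x hx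
      have h1 := ENNReal.tendsto_atTop_zero_of_tsum_ne_top hx.ne
      have h2 : Tendsto (fun i => F i x) atTop (𝓝 0) := by
        have := (ENNReal.tendsto_toReal ENNReal.zero_ne_top).comp h1
        simpa [Function.comp_def, ENNReal.toReal_ofReal (hF0 _ x)] using this
      have h3 : Tendsto (fun i => min 1 (birkhoffSum T f₀ (n i) x / Real.log (n i))) atTop
          (𝓝 0) := by
        have := h2.div_const (f₀ x)
        simpa [hF, mul_div_cancel_right₀ _ (hpos x).ne'] using this
      -- Once the minimum is below `1` the truncation is inactive.
      refine h3.congr' ?_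
      filter_upwards [h3.eventually_lt_const one_pos] with i hi
      exact min_eq_right (le_of_not_ge fun h => by simp [min_eq_left h] at hi)
    refine ⟨n, hnt, fun f hf => ?_⟩
    filter_upwards [hconv, ae_exists_abs_birkhoffSum_le_mul hT hf hf₀ hfm₀ hpos] with x hx ⟨C, hC⟩
    refine squeeze_zero_norm (fun i => ?_) (by simpa using hx.const_mul C)
    rw [Real.norm_eq_abs, abs_div, abs_of_nonneg (Real.log_natCast_nonneg (n i)), ← mul_div_assoc]
    exact div_le_div_of_nonneg_right (hC (n i)) (Real.log_natCast_nonneg _)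

end Criterion

/-! ### Continuity properties of the weak topology -/

section WeakTopology

variable {X : Type*} [MeasurableSpace X] {m : Measure X}

open scoped symmDiff

namespace MPAut

theorem tendsto_iff {ι : Type*} {l : Filter ι} {S : ι → MPAut m} {T : MPAut m} :
    Tendsto S l (𝓝 T) ↔ ∀ A : Set X, MeasurableSet A → m A < ∞ →
      Tendsto (fun i => m ((S i ⁻¹' A) ∆ (T ⁻¹' A))) l (𝓝 0) := by
  have h : ∀ A : MeasuredSets m, Tendsto (fun i => (S i).preimage A) l (𝓝 (T.preimage A)) ↔
      Tendsto (fun i => m ((S i ⁻¹' (A : Set X)) ∆ (T ⁻¹' (A : Set X)))) l (𝓝 0) := fun A => by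
    rw [tendsto_iff_edist_tendsto_0]
    rfl
  simp only [nhds_iInf, nhds_induced, tendsto_iInf, tendsto_comap_iff, Function.comp_def, h]
  exact ⟨fun H A hA hfin => H ⟨A, hA⟩ hfin, fun H A hfin => H A A.2 hfin⟩

/-- The weak topology makes `S ↦ f ∘ S` continuous into `L¹`: for indicators this is its definition,
and it passes to sums and to `L¹` limits because every `f ↦ f ∘ S` is an isometry of `L¹`. -/
theorem tendsto_lintegral_enorm_comp_sub (T : MPAut m) {f : X → ℝ} (hf : Integrable f m) :
    Tendsto (fun S : MPAut m => ∫⁻ x, ‖f (S x) - f (T x)‖ₑ ∂m) (𝓝 T) (𝓝 0) := by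
  have hcomp : ∀ {g : X → ℝ} (_ : Integrable g m) (S : MPAut m),
      Integrable (fun x => g (S x)) m := fun hg S => S.measurePreserving.integrable_comp_of_integrable hg
  have hmeas : ∀ {g : X → ℝ} (_ : Integrable g m) (S : MPAut m),
      AEMeasurable (fun x => ‖g (S x) - g (T x)‖ₑ) m := fun hg S =>
    ((hcomp hg S).sub (hcomp hg T)).aestronglyMeasurable.enorm
  have hinv : ∀ (g : X → ℝ) (S : MPAut m), ∫⁻ x, ‖g (S x)‖ₑ ∂m = ∫⁻ x, ‖g x‖ₑ ∂m := fun g S =>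
    S.measurePreserving.lintegral_comp_emb S.toEquiv.measurableEmbedding fun x => ‖g x‖ₑ
  refine Integrable.induction (P := fun f : X → ℝ => Tendsto
    (fun S : MPAut m => ∫⁻ x, ‖f (S x) - f (T x)‖ₑ ∂m) (𝓝 T) (𝓝 0)) ?_ ?_ ?_ ?_ hf
  · intro c s hs hfin
    have h1 := tendsto_iff.1 (tendsto_id (x := 𝓝 T)) s hs hfin
    have h2 := ENNReal.Tendsto.const_mul (a := ‖c‖ₑ) h1 (Or.inr enorm_ne_top)
    rw [mul_zero] at h2
    refine h2.congr fun S => ?_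
    rw [id_eq, ← lintegral_indicator_const ((S.toEquiv.measurable hs).symmDiff (T.toEquiv.measurable hs))]
    refine lintegral_congr fun x => ?_
    by_cases hS : S x ∈ s <;> by_cases hT : T x ∈ s <;>
      simp [Set.indicator, Set.mem_symmDiff, hS, hT]
  · intro f g _ hf hg hPf hPg
    have := hPf.add hPg
    rw [add_zero] at this
    refine tendsto_of_tendsto_of_tendsto_of_le_of_le tendsto_const_nhds this (fun _ => bot_le)
      fun S => ?_
    dsimp only
    rw [← lintegral_add_left' (hmeas hf S)]
    refine lintegral_mono fun x => ?_
    simp only [Pi.add_apply]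
    rw [add_sub_add_comm]
    exact enorm_add_le _ _
  · refine isClosed_iff_frequently.2 fun f hfreq => ENNReal.tendsto_nhds_zero.2 fun ε hε => ?_
    have hε3 : 0 < ε / 3 := ENNReal.div_pos hε.ne' (by norm_num)
    obtain ⟨g, hg, hgf⟩ := (hfreq.and_eventually (Metric.eball_mem_nhds f hε3)).exists
    have hgi := L1.integrable_coeFn g
    have hfi := L1.integrable_coeFn f
    have hd : ∫⁻ x, ‖f x - g x‖ₑ ∂m < ε / 3 := by
      have h := Metric.mem_eball.1 hgf
      rw [edist_comm, L1.edist_def] at h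
      simpa only [edist_eq_enorm_sub] using h
    filter_upwards [ENNReal.tendsto_nhds_zero.1 hg _ hε3] with S hS
    calc ∫⁻ x, ‖f (S x) - f (T x)‖ₑ ∂m
        ≤ ∫⁻ x, (‖f (S x) - g (S x)‖ₑ + (‖g (S x) - g (T x)‖ₑ + ‖f (T x) - g (T x)‖ₑ)) ∂m := by
          refine lintegral_mono fun x => ?_
          have h : f (S x) - f (T x) = (f (S x) - g (S x)) +
            ((g (S x) - g (T x)) - (f (T x) - g (T x))) := by ring
          rw [h]
          exact (enorm_add_le _ _).trans (add_le_add le_rfl enorm_sub_le)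
      _ = ∫⁻ x, ‖f x - g x‖ₑ ∂m + (∫⁻ x, ‖g (S x) - g (T x)‖ₑ ∂m + ∫⁻ x, ‖f x - g x‖ₑ ∂m) := by
          have h0 : AEMeasurable (fun x => ‖f (S x) - g (S x)‖ₑ) m :=
            ((hcomp hfi S).sub (hcomp hgi S)).aestronglyMeasurable.enorm
          rw [lintegral_add_left' h0,
            lintegral_add_left' (hmeas hgi S)]
          have h1 := hinv (fun x => f x - g x) S
          have h2 := hinv (fun x => f x - g x) T
          rw [h1, h2]
      _ ≤ ε / 3 + (ε / 3 + ε / 3) := add_le_add hd.le (add_le_add hS hd.le)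
      _ = ε := by rw [← add_assoc, ENNReal.add_thirds]
  · intro f g hfg _ hP
    refine hP.congr fun S => lintegral_congr_ae ?_
    filter_upwards [S.measurePreserving.quasiMeasurePreserving.ae hfg,
      T.measurePreserving.quasiMeasurePreserving.ae hfg] with x hx hy
    rw [hx, hy]

/-- Telescoping: the difference at `j + 1` is the difference at `j` composed with `S`, of unchanged
norm, plus `g ∘ S - g ∘ T` for the fixed function `g = f ∘ T^j`. -/
theorem tendsto_lintegral_enorm_iterate_sub (T : MPAut m) {f : X → ℝ} (hf : Integrable f m)
    (j : ℕ) : Tendsto (fun S : MPAut m => ∫⁻ x, ‖f (S^[j] x) - f (T^[j] x)‖ₑ ∂m) (𝓝 T) (𝓝 0) := by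
  induction j with
  | zero => simp
  | succ j ih =>
    have hTj := (T.measurePreserving.iterate j).integrable_comp_of_integrable hf
    have h := ih.add (T.tendsto_lintegral_enorm_comp_sub hTj)
    rw [add_zero] at h
    refine tendsto_of_tendsto_of_tendsto_of_le_of_le tendsto_const_nhds h (fun _ => bot_le)
      fun S => ?_
    have hSj := (S.measurePreserving.iterate j).integrable_comp_of_integrable hf
    have h1 := S.measurePreserving.lintegral_comp_emb S.toEquiv.measurableEmbedding
      fun x => ‖f (S^[j] x) - f (T^[j] x)‖ₑ
    dsimp only
    rw [← h1, ← lintegral_add_left']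
    · refine lintegral_mono fun x => ?_
      simp only [Function.iterate_succ_apply, Function.comp_apply]
      refine le_trans (le_of_eq ?_) (enorm_add_le _ _)
      rw [sub_add_sub_cancel]
    · exact (S.measurePreserving.integrable_comp_of_integrable
        (hSj.sub hTj)).aestronglyMeasurable.enorm

/-- As `min 1` is 1-Lipschitz and `f ≤ 1`, two integrands differ by at most `(1 / log n) ∑_{j<n} |f
∘ S^j - f ∘ T^j|`. -/
theorem continuous_truncatedLogAverage {f : X → ℝ} (hf : Integrable f m) (hfm : Measurable f)
    (hpos : ∀ x, 0 ≤ f x) (hle : ∀ x, f x ≤ 1) {n : ℕ} (hn : 2 ≤ n) :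
    Continuous fun S : MPAut m => truncatedLogAverage m S f n := by
  have hlog : 0 < Real.log n := Real.log_pos (by exact_mod_cast hn)
  refine continuous_iff_continuousAt.2 fun T => ?_
  refine tendsto_integral_of_L1 _ (integrable_truncatedLog T.measurePreserving hf hfm hpos
    n).aestronglyMeasurable (Eventually.of_forall fun S => integrable_truncatedLog
      S.measurePreserving hf hfm hpos n) ?_
  have hsum : Tendsto (fun S : MPAut m => ENNReal.ofReal (1 / Real.log n) *
      ∑ j ∈ Finset.range n, ∫⁻ x, ‖f (S^[j] x) - f (T^[j] x)‖ₑ ∂m) (𝓝 T) (𝓝 0) := by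
    have h := ENNReal.Tendsto.const_mul (a := ENNReal.ofReal (1 / Real.log n))
      (tendsto_finsetSum (Finset.range n) fun j _ => T.tendsto_lintegral_enorm_iterate_sub hf j)
      (Or.inr ENNReal.ofReal_ne_top)
    simpa using h
  refine tendsto_of_tendsto_of_tendsto_of_le_of_le tendsto_const_nhds hsum (fun _ => bot_le)
    fun S => ?_
  have hj : ∀ j, AEMeasurable (fun x => ‖f (S^[j] x) - f (T^[j] x)‖ₑ) m := fun j =>
    (((S.measurePreserving.iterate j).integrable_comp_of_integrable hf).sub
      ((T.measurePreserving.iterate j).integrable_comp_of_integrable hf)).aestronglyMeasurable.enorm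
  dsimp only
  rw [← lintegral_finsetSum' _ fun j _ => hj j,
    ← lintegral_const_mul'' _ (Finset.aemeasurable_fun_sum _ fun j _ => hj j)]
  refine lintegral_mono fun x => ?_
  have hsub : birkhoffSum S f n x - birkhoffSum T f n x
      = ∑ j ∈ Finset.range n, (f (S^[j] x) - f (T^[j] x)) := by
    simp only [birkhoffSum, Finset.sum_sub_distrib]
  have hreal : |min 1 (birkhoffSum S f n x / Real.log n) * f x -
      min 1 (birkhoffSum T f n x / Real.log n) * f x| ≤
      1 / Real.log n * ∑ j ∈ Finset.range n, |f (S^[j] x) - f (T^[j] x)| := by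
    rw [← sub_mul, abs_mul, abs_of_nonneg (hpos x)]
    refine (mul_le_of_le_one_right (abs_nonneg _) (hle x)).trans ?_
    refine (abs_min_sub_min_le_max _ _ _ _).trans ?_
    rw [sub_self, abs_zero, max_eq_right (abs_nonneg _), ← sub_div, abs_div, abs_of_pos hlog, hsub,
      div_eq_mul_one_div, mul_comm]
    exact mul_le_mul_of_nonneg_left (Finset.abs_sum_le_sum_abs _ _) (by positivity)
  simp only [Real.enorm_eq_ofReal_abs]
  rw [← ENNReal.ofReal_sum_of_nonneg fun _ _ => abs_nonneg _, ← ENNReal.ofReal_mul (by positivity)]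
  exact ENNReal.ofReal_le_ofReal hreal

end MPAut

theorem truncatedLogAverage_congr {T S : X → X} (hT : MeasurePreserving T m m) (h : T =ᵐ[m] S)
    (f : X → ℝ) (n : ℕ) : truncatedLogAverage m T f n = truncatedLogAverage m S f n := by
  refine integral_congr_ae ?_
  filter_upwards [iterate_ae_eq hT.quasiMeasurePreserving h] with x hx
  simp only [birkhoffSum, hx]

theorem exists_pos_le_one_integrable (m : Measure X) [SigmaFinite m] :
    ∃ f : X → ℝ, Measurable f ∧ Integrable f m ∧ ∀ x, 0 < f x ∧ f x ≤ 1 := by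
  obtain ⟨g, hg0, hgm, hg⟩ := exists_pos_lintegral_lt_of_sigmaFinite m one_ne_zero
  refine ⟨fun x => min 1 (g x), by fun_prop, ⟨Measurable.aestronglyMeasurable (by fun_prop), ?_⟩,
    fun x => ⟨lt_min one_pos (by exact_mod_cast hg0 x), min_le_left _ _⟩⟩
  refine lt_of_le_of_lt (lintegral_mono fun x => ?_) (hg.trans ENNReal.one_lt_top)
  rw [Real.enorm_eq_ofReal (le_min zero_le_one (g x).coe_nonneg)]
  exact (ENNReal.ofReal_le_ofReal (min_le_right _ _)).trans (by simp)

namespace MPGroup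

theorem isGδ_hasLogNegligibleSums [SigmaFinite m] :
    IsGδ {T : MPGroup m | T.HasLogNegligibleSums} := by
  obtain ⟨f, hfm, hf, hf01⟩ := exists_pos_le_one_integrable m
  let Φ : ℕ → MPGroup m → ℝ := fun n => Quotient.lift
    (fun S : MPAut m => truncatedLogAverage m S f n)
    fun S S' h => truncatedLogAverage_congr S.measurePreserving (MPAut.ae_eq_of_leftRel h) f n
  have hΦ : ∀ n, 2 ≤ n → Continuous (Φ n) := fun n hn =>
    (MPAut.continuous_truncatedLogAverage hf hfm (fun x => (hf01 x).1.le)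
      (fun x => (hf01 x).2) hn).quotient_lift _
  have hset : {T : MPGroup m | T.HasLogNegligibleSums} =
      ⋂ i : ℕ, ⋃ n : ℕ, ⋃ _ : i + 2 ≤ n, {T | Φ n T < (1 / 2) ^ i} := by
    ext T
    induction T using Quotient.inductionOn with
    | h S =>
      simp only [Set.mem_iInter, Set.mem_iUnion, exists_prop]
      exact hasLogNegligibleSums_iff S.measurePreserving hf hfm fun x => (hf01 x).1
  rw [hset]
  refine IsGδ.iInter fun i => IsOpen.isGδ ?_
  exact isOpen_iUnion fun n => isOpen_iUnion fun hn =>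
    isOpen_lt (hΦ n (by omega)) continuous_const

end MPGroup

end WeakTopology

/-! ### Log lower bounded transformations -/

section ReturnTimes

variable {X : Type*}

/-- The points of `A` whose orbit does not return to `A` before time `k`. -/
def lateReturns (T : X → X) (A : Set X) (k : ℕ) : Set X :=
  {x | x ∈ A ∧ ∀ n, 1 ≤ n → n < k → T^[n] x ∉ A}

theorem le_firstReturnTime {T : X → X} {A : Set X} {k : ℕ} {x : X}
    (hx : x ∈ lateReturns T A k) : (k : ℝ≥0∞) ≤ firstReturnTime T A x := by
  refine le_iInf₂ fun n hn => ?_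
  by_contra h
  exact hx.2 n hn.1 (by exact_mod_cast not_le.1 h) hn.2

/-- The points of `A` whose orbit visits `A` at most `L` times before time `N`. -/
def rareVisits (T : X → X) (A : Set X) (N L : ℕ) : Set X :=
  {x | x ∈ A ∧ birkhoffSum T (A.indicator fun _ => (1 : ℝ)) N x ≤ L}

theorem birkhoffSum_indicator_mono (T : X → X) (A : Set X) {M N : ℕ} (h : M ≤ N) (x : X) :
    birkhoffSum T (A.indicator fun _ => (1 : ℝ)) M x ≤
      birkhoffSum T (A.indicator fun _ => (1 : ℝ)) N x :=
  Finset.sum_le_sum_of_subset_of_nonneg (Finset.range_mono h) fun _ _ _ =>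
    Set.indicator_nonneg (fun _ _ => zero_le_one) _

/-- Split by the first return time `n`. If `n < K`, time `0` uses up one visit and at least `L * K +
1` steps remain after time `n`, with at most `L` visits. The `+ 1` in the window makes the case `L =
0` empty, since time `0` is a visit. -/
theorem rareVisits_succ_subset (T : X → X) (A : Set X) (K L : ℕ) :
    rareVisits T A ((L + 1) * K + 1) (L + 1) ⊆ lateReturns T A K ∪
      ⋃ n ∈ Finset.Ico 1 K, lateReturns T A n ∩ T^[n] ⁻¹' rareVisits T A (L * K + 1) L := by
  rintro x ⟨hxA, hx⟩
  by_cases hret : ∃ n, 1 ≤ n ∧ T^[n] x ∈ A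
  · classical
    set n := Nat.find hret with hn
    obtain ⟨hn1, hnA⟩ := Nat.find_spec hret
    have hmin : ∀ j, 1 ≤ j → j < n → T^[j] x ∉ A := fun j h1 hj hA =>
      Nat.find_min hret hj ⟨h1, hA⟩
    by_cases hnK : n < K
    · refine Or.inr (Set.mem_iUnion₂.2 ⟨n, Finset.mem_Ico.2 ⟨hn1, hnK⟩, ⟨hxA, hmin⟩, hnA, ?_⟩)
      have h1 : birkhoffSum T (A.indicator fun _ => (1 : ℝ)) (n + (L * K + 1)) x ≤ L + 1 :=
        (birkhoffSum_indicator_mono T A (N := (L + 1) * K + 1)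
          (by rw [add_mul, one_mul]; omega) x).trans (by exact_mod_cast hx)
      have h2 : 1 ≤ birkhoffSum T (A.indicator fun _ => (1 : ℝ)) n x := by
        refine le_trans ?_ (birkhoffSum_indicator_mono T A hn1 x)
        simp [hxA]
      rw [birkhoffSum_add] at h1
      linarith
    · exact Or.inl ⟨hxA, fun j h1 hj => hmin j h1 (hj.trans_le (not_lt.1 hnK))⟩
  · exact Or.inl ⟨hxA, fun j h1 _ hj => hret ⟨j, h1, hj⟩⟩

variable [MeasurableSpace X] {m : Measure X}

theorem measurableSet_lateReturns {T : X → X} (hT : Measurable T) {A : Set X}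
    (hA : MeasurableSet A) (k : ℕ) : MeasurableSet (lateReturns T A k) := by
  have h : lateReturns T A k = A ∩ ⋂ n, ⋂ _ : 1 ≤ n, ⋂ _ : n < k, (T^[n] ⁻¹' A)ᶜ := by
    ext x
    simp [lateReturns]
  rw [h]
  refine hA.inter ?_
  exact MeasurableSet.iInter fun n => MeasurableSet.iInter fun _ => MeasurableSet.iInter fun _ =>
    ((hT.iterate n) hA).compl

theorem measurableSet_rareVisits {T : X → X} (hT : Measurable T) {A : Set X}
    (hA : MeasurableSet A) (N L : ℕ) : MeasurableSet (rareVisits T A N L) :=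
  hA.inter (measurableSet_le (measurable_birkhoffSum hT (measurable_const.indicator hA) N)
    measurable_const)

/-- The sets `T^n (lateReturns T A n)`, `n ≥ 1`, are disjoint: `y` lies in the one for which `n` is
the time elapsed since the last earlier visit to `A`. Invertibility lets the sum be computed at
these images, inside `E`. -/
theorem sum_measure_lateReturns_inter_le (T : MPAut m) {A E : Set X} (hA : MeasurableSet A)
    (hE : MeasurableSet E) (K : ℕ) :
    ∑ n ∈ Finset.Ico 1 K, m (lateReturns T A n ∩ T^[n] ⁻¹' E) ≤ m E := by
  have hback : ∀ n, Function.LeftInverse (⇑(T⁻¹))^[n] T^[n] := fun n =>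
    Function.LeftInverse.iterate T.inv_apply_apply n
  have hforth : ∀ n, Function.LeftInverse T^[n] (⇑(T⁻¹))^[n] := fun n =>
    Function.LeftInverse.iterate T.apply_inv_apply n
  have hB : ∀ n, MeasurableSet ((⇑(T⁻¹))^[n] ⁻¹' lateReturns T A n ∩ E) := fun n =>
    (((T⁻¹).toEquiv.measurable.iterate n)
      (measurableSet_lateReturns T.toEquiv.measurable hA n)).inter hE
  have h1 : ∀ n, m (lateReturns T A n ∩ T^[n] ⁻¹' E)
      = m ((⇑(T⁻¹))^[n] ⁻¹' lateReturns T A n ∩ E) := fun n => by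
    rw [← (T.measurePreserving.iterate n).measure_preimage (hB n).nullMeasurableSet]
    congr 1
    ext x
    simp only [Set.mem_inter_iff, Set.mem_preimage, hback n x]
  simp only [h1]
  rw [← measure_biUnion_finset _ fun n _ => hB n]
  · exact measure_mono (Set.iUnion₂_subset fun n _ => Set.inter_subset_right)
  · have key : ∀ n l, 1 ≤ n → n < l → Disjoint ((⇑(T⁻¹))^[n] ⁻¹' lateReturns T A n ∩ E)
        ((⇑(T⁻¹))^[l] ⁻¹' lateReturns T A l ∩ E) := by
      intro n l hn hnl
      refine Set.disjoint_left.2 fun y hy hy' => ?_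
      refine hy'.1.2 (l - n) (by omega) (by omega) ?_
      have h2 : T^[l - n] ((⇑(T⁻¹))^[l] y) = (⇑(T⁻¹))^[n] y := by
        conv_lhs => rw [show l = (l - n) + n by omega, Function.iterate_add_apply]
        rw [Nat.add_sub_cancel]
        exact hforth (l - n) _
      rw [h2]
      exact hy.1.1
    intro n hn l hl hne
    have hn1 := (Finset.mem_Ico.1 hn).1
    have hl1 := (Finset.mem_Ico.1 hl).1
    rcases lt_or_gt_of_ne hne with h | h
    · exact key n l hn1 h
    · exact (key l n hl1 h).symm

theorem measure_rareVisits_le (T : MPAut m) {A : Set X} (hA : MeasurableSet A) (K L : ℕ) :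
    m (rareVisits T A (L * K + 1) L) ≤ L * m (lateReturns T A K) := by
  induction L with
  | zero =>
    have h : rareVisits T A (0 * K + 1) 0 = ∅ := by
      refine Set.eq_empty_of_forall_notMem fun x hx => ?_
      have h1 := hx.2
      simp [hx.1] at h1
      linarith
    rw [h, measure_empty]
    exact bot_le
  | succ L ih =>
    have hE := measurableSet_rareVisits T.toEquiv.measurable hA (L * K + 1) L
    calc m (rareVisits T A ((L + 1) * K + 1) (L + 1))
        ≤ m (lateReturns T A K) + ∑ n ∈ Finset.Ico 1 K,
            m (lateReturns T A n ∩ T^[n] ⁻¹' rareVisits T A (L * K + 1) L) :=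
          (measure_mono (rareVisits_succ_subset T A K L)).trans
            ((measure_union_le _ _).trans (add_le_add le_rfl (measure_biUnion_finset_le _ _)))
      _ ≤ m (lateReturns T A K) + L * m (lateReturns T A K) :=
          add_le_add le_rfl ((sum_measure_lateReturns_inter_le T hA hE K).trans ih)
      _ = ((L + 1 : ℕ) : ℝ≥0∞) * m (lateReturns T A K) := by push_cast; ring

/-- Markov's inequality for `log φ_A`. -/
theorem log_mul_measure_lateReturns_le {T : X → X} (hT : Measurable T) {A : Set X}
    (hA : MeasurableSet A) (k : ℕ) : ENNReal.ofReal (Real.log k) * m (lateReturns T A k) ≤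
      ∫⁻ x in A, (ENNReal.log (firstReturnTime T A x)).toENNReal ∂m := by
  rw [← setLIntegral_const]
  refine le_trans (setLIntegral_mono' (measurableSet_lateReturns hT hA k) fun x hx => ?_)
    (lintegral_mono_set (s := lateReturns T A k) (fun x hx => hx.1))
  have h1 := EReal.toENNReal_le_toENNReal (ENNReal.log_monotone (le_firstReturnTime hx))
  refine le_trans (le_of_eq ?_) h1
  rcases Nat.eq_zero_or_pos k with rfl | hk
  · simp
  · rw [ENNReal.log_pos_real (by exact_mod_cast hk.ne') (ENNReal.natCast_ne_top k),
      EReal.toENNReal_of_ne_top (EReal.coe_ne_top _), EReal.toReal_coe, ENNReal.toReal_natCast]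

theorem HasLogNegligibleSums.not_logLowerBounded {T : MPAut m} (hT : HasLogNegligibleSums T m) :
    ¬ LogLowerBounded T m := by
  rintro ⟨-, -, A, hA, hpos, hfin, hI⟩
  set I := ∫⁻ x in A, (ENNReal.log (firstReturnTime T A x)).toENNReal ∂m with hIdef
  obtain ⟨n, hn, H⟩ := hT
  have hapos : 0 < m.real A := ENNReal.toReal_pos hpos.ne' hfin.ne
  -- Chosen so that the final bound `5 ε I` on the rarely returning part of `A` is below `m(A)/2`;
  -- the `+ 1` covers `I = 0`.
  set ε : ℝ := m.real A / (10 * (I.toReal + 1)) with hε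
  have hI0 : 0 ≤ I.toReal := ENNReal.toReal_nonneg
  have hεpos : 0 < ε := by positivity
  have hεI : 5 * ε * I.toReal < m.real A / 2 := by
    have h : ε * (10 * (I.toReal + 1)) = m.real A := div_mul_cancel₀ _ (by positivity)
    nlinarith
  have hAfin : IsFiniteMeasure (m.restrict A) := isFiniteMeasure_restrict.2 hfin.ne
  set f : X → ℝ := A.indicator fun _ => (1 : ℝ) with hf
  have hfm : Measurable f := measurable_const.indicator hA
  have hfi : Integrable f m := (integrable_indicator_iff hA).2 (integrableOn_const hfin.ne)
  have hmeasure : Tendsto (fun k => m.restrict A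
      {x | ENNReal.ofReal ε ≤ edist (birkhoffSum T f (n k) x / Real.log (n k)) 0}) atTop (𝓝 0) :=
    tendstoInMeasure_of_tendsto_ae (f := fun k x => birkhoffSum T f (n k) x / Real.log (n k))
      (fun k => ((measurable_birkhoffSum T.toEquiv.measurable hfm (n k)).div_const
        _).aestronglyMeasurable) (ae_restrict_of_ae (H f hfi)) (ENNReal.ofReal ε) (by simpa)
  have hlogo : Tendsto (fun K : ℕ => Real.log K / K) atTop (𝓝 0) := by
    have := Real.isLittleO_log_id_atTop.tendsto_div_nhds_zero.comp
      (tendsto_natCast_atTop_atTop (R := ℝ))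
    exact this
  have hlogt : Tendsto (fun K : ℕ => Real.log K) atTop atTop :=
    Real.tendsto_log_atTop.comp tendsto_natCast_atTop_atTop
  -- The first condition gives `N ≤ K^4`, the second `L < K` and so `L * K + 1 ≤ N`; the third
  -- absorbs the rounding of `L` into `ε log K`, which turns `4 ε` into `5 ε`.
  have hK : ∀ᶠ K : ℕ in atTop, 4 ≤ K ∧ 4 * ε * Real.log K + 1 < K ∧ 1 ≤ ε * Real.log K := by
    filter_upwards [eventually_ge_atTop 4, hlogo.eventually_lt_const
      (show (0 : ℝ) < 1 / (8 * ε) by positivity), hlogt.eventually_ge_atTop (1 / ε)] with K h4 h1 h2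
    have hK0 : (4 : ℝ) ≤ K := by exact_mod_cast h4
    refine ⟨h4, ?_, ?_⟩
    · rw [div_lt_div_iff₀ (by linarith) (by positivity)] at h1
      linarith
    · rw [div_le_iff₀ hεpos] at h2
      linarith
  have hsqrt : Tendsto (fun k => Nat.sqrt (n k)) atTop atTop := by
    refine Tendsto.comp (g := Nat.sqrt) (tendsto_atTop_atTop.2 fun b => ⟨b * b, fun a ha => ?_⟩) hn
    exact Nat.le_sqrt.2 ha
  obtain ⟨k, ⟨hK4, hK1, hK2⟩, hk⟩ := ((hsqrt.eventually hK).and (hmeasure.eventually_lt_const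
    (show (0 : ℝ≥0∞) < ENNReal.ofReal (m.real A / 2) by simpa using hapos))).exists
  set N := n k
  set K := Nat.sqrt N with hKdef
  have hKR : (4 : ℝ) ≤ K := by exact_mod_cast hK4
  have hNK : K * K ≤ N := Nat.sqrt_le N
  have hN1 : (1 : ℝ) < N := by exact_mod_cast (show 1 < N by nlinarith)
  have hlogN : 0 < Real.log N := Real.log_pos hN1
  have hlogK : 0 < Real.log K := Real.log_pos (by linarith)
  have hlog : Real.log N ≤ 4 * Real.log K := by
    have h1 : (N : ℝ) < (K + 1) * (K + 1) := by exact_mod_cast Nat.lt_succ_sqrt N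
    have h2 : (N : ℝ) ≤ (K : ℝ) ^ 4 := by nlinarith [sq_nonneg ((K : ℝ) ^ 2 - K - 1)]
    calc Real.log N ≤ Real.log ((K : ℝ) ^ 4) := Real.log_le_log (by linarith) h2
      _ = 4 * Real.log K := by rw [Real.log_pow]; norm_num
  set L := ⌈ε * Real.log N⌉₊
  have hLle : ε * Real.log N ≤ L := Nat.le_ceil _
  have hLlt : (L : ℝ) < ε * Real.log N + 1 := Nat.ceil_lt_add_one (by positivity)
  have hεlog : ε * Real.log N ≤ 4 * ε * Real.log K := by nlinarith
  have hLK : L < K := by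
    have : (L : ℝ) < K := by linarith
    exact_mod_cast this
  have hLKN : L * K + 1 ≤ N := by nlinarith
  have hsub : A ⊆ (A ∩ {x | ENNReal.ofReal ε ≤ edist (birkhoffSum T f N x / Real.log N) 0}) ∪
      rareVisits T A (L * K + 1) L := by
    intro x hx
    by_cases h : ENNReal.ofReal ε ≤ edist (birkhoffSum T f N x / Real.log N) 0
    · exact Or.inl ⟨hx, h⟩
    · refine Or.inr ⟨hx, (birkhoffSum_indicator_mono T A hLKN x).trans ?_⟩
      rw [not_le, edist_dist, ENNReal.ofReal_lt_ofReal_iff hεpos, Real.dist_eq, sub_zero] at h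
      have h1 := (le_abs_self _).trans h.le
      rw [div_le_iff₀ hlogN] at h1
      exact h1.trans hLle
  have hrare : m.real (rareVisits T A (L * K + 1) L) ≤ 5 * ε * I.toReal := by
    have h1 : ENNReal.ofReal (Real.log K) * m (rareVisits T A (L * K + 1) L) ≤ L * I := by
      calc _ ≤ ENNReal.ofReal (Real.log K) * (L * m (lateReturns T A K)) := by
            gcongr; exact measure_rareVisits_le T hA K L
        _ = L * (ENNReal.ofReal (Real.log K) * m (lateReturns T A K)) := by ring
        _ ≤ L * I := by
            gcongr; exact log_mul_measure_lateReturns_le T.toEquiv.measurable hA K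
    have h2 := ENNReal.toReal_mono (ENNReal.mul_ne_top (ENNReal.natCast_ne_top L) hI.ne) h1
    rw [ENNReal.toReal_mul, ENNReal.toReal_mul, ENNReal.toReal_ofReal hlogK.le,
      ENNReal.toReal_natCast] at h2
    have h3 : (L : ℝ) * I.toReal ≤ 5 * ε * Real.log K * I.toReal :=
      mul_le_mul_of_nonneg_right (by linarith) hI0
    refine le_of_mul_le_mul_left (h2.trans (h3.trans (le_of_eq ?_))) hlogK
    ring
  have hlarge : m.real (A ∩ {x | ENNReal.ofReal ε ≤ edist (birkhoffSum T f N x / Real.log N) 0})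
      < m.real A / 2 := by
    rw [Measure.restrict_apply' hA, Set.inter_comm] at hk
    have := ENNReal.toReal_lt_of_lt_ofReal hk
    exact this
  have hfinal := (measureReal_mono hsub (measure_ne_top_of_subset (Set.union_subset
    Set.inter_subset_left fun x hx => hx.1) hfin.ne)).trans (measureReal_union_le _ _)
  linarith

end ReturnTimes

/-! ### Extension of acyclic partial injections -/

section AcyclicExtension

/-- The space `W` with a forward half-line attached at each point outside `D` and a backward
half-line attached at each point outside `σ '' D`. -/
abbrev ChainSpace {W : Type*} (D : Set W) (σ : W → W) : Type _ :=
  W ⊕ ((Dᶜ : Set W) × ℕ) ⊕ (((σ '' D)ᶜ : Set W) × ℕ)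

open Classical in
/-- The map that follows `σ` on `D` and moves along the attached half-lines. -/
noncomputable def chainMap {W : Type*} (D : Set W) (σ : W → W) : ChainSpace D σ → ChainSpace D σ
  | .inl w => if h : w ∈ D then .inl (σ w) else .inr (.inl (⟨w, h⟩, 0))
  | .inr (.inl (w, n)) => .inr (.inl (w, n + 1))
  | .inr (.inr (c, 0)) => .inl c
  | .inr (.inr (c, n + 1)) => .inr (.inr (c, n))

/-- The forward half-lines provide images for the points outside `D`, the backward ones preimages
for the points outside `σ '' D`. -/
theorem chainMap_bijective {W : Type*} {D : Set W} {σ : W → W} (hσ : Set.InjOn σ D) :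
    Function.Bijective (chainMap D σ) := by
  constructor
  · rintro (w | ⟨w, n⟩ | ⟨⟨c, hc⟩, _ | n⟩) (w' | ⟨w', n'⟩ | ⟨⟨c', hc'⟩, _ | n'⟩) h
    · by_cases h1 : w ∈ D <;> by_cases h2 : w' ∈ D <;> simp [chainMap, h1, h2] at h ⊢
      · exact hσ h1 h2 h
      · exact h
    · by_cases h1 : w ∈ D <;> simp [chainMap, h1] at h
    · by_cases h1 : w ∈ D <;> simp [chainMap, h1] at h
      exact absurd ⟨w, h1, h⟩ hc'
    · by_cases h1 : w ∈ D <;> simp [chainMap, h1] at h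
    · by_cases h1 : w' ∈ D <;> simp [chainMap, h1] at h
    · simpa [chainMap] using h
    · simp [chainMap] at h
    · simp [chainMap] at h
    · by_cases h1 : w' ∈ D <;> simp [chainMap, h1] at h
      exact absurd ⟨w', h1, h.symm⟩ hc
    · simp [chainMap] at h
    · simpa [chainMap] using h
    · simp [chainMap] at h
    · by_cases h1 : w' ∈ D <;> simp [chainMap, h1] at h
    · simp [chainMap] at h
    · simp [chainMap] at h
    · simpa [chainMap] using h
  · rintro (w | ⟨⟨w, hw⟩, _ | n⟩ | ⟨c, n⟩)
    · by_cases h : w ∈ σ '' D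
      · obtain ⟨v, hv, rfl⟩ := h
        exact ⟨.inl v, by simp [chainMap, hv]⟩
      · exact ⟨.inr (.inr (⟨w, h⟩, 0)), rfl⟩
    · have hw' : w ∉ D := hw
      exact ⟨.inl w, by simp [chainMap, hw']⟩
    · exact ⟨.inr (.inl (⟨w, hw⟩, n)), rfl⟩
    · exact ⟨.inr (.inr (c, n + 1)), rfl⟩

/-- A finite partial injection along which some potential increases extends to a permutation
along which some potential increases. -/
theorem exists_perm_extending {ι : Type*} [Countable ι] [Infinite ι] (D : Finset ι) (σ : ι → ι)
    (hσ : Set.InjOn σ D) (h : ι → ℕ) (hh : ∀ j ∈ D, h j < h (σ j)) :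
    ∃ e : Equiv.Perm ι, (∀ j ∈ D, e j = σ j) ∧ ∃ H : ι → ℤ, ∀ j, H j < H (e j) := by
  classical
  -- The extra point `x` guarantees at least one half-line, so that the attached points are
  -- countably infinite and can be matched with the complement of `F`.
  obtain ⟨x, hx⟩ := Infinite.exists_notMem_finset (D ∪ D.image σ)
  set F : Finset ι := insert x (D ∪ D.image σ) with hF
  let W := {j // j ∈ F}
  let D' : Set W := {w | w.1 ∈ D}
  let σ' : W → W := fun w => if hw : w.1 ∈ D then
    ⟨σ w.1, Finset.mem_insert_of_mem (Finset.mem_union_right _ (Finset.mem_image_of_mem σ hw))⟩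
    else w
  have hσ'_val : ∀ w : W, w.1 ∈ D → (σ' w).1 = σ w.1 := fun w hw => by simp [σ', hw]
  have hσ' : Set.InjOn σ' D' := fun w hw w' hw' heq =>
    Subtype.ext (hσ hw hw' (by rw [← hσ'_val w hw, ← hσ'_val w' hw', heq]))
  have hxD : x ∉ D := fun h => hx (Finset.mem_union_left _ h)
  have : Nonempty (D'ᶜ : Set W) := ⟨⟨⟨x, Finset.mem_insert_self _ _⟩, hxD⟩⟩
  have : Infinite {j // j ∉ F} := by
    have := F.finite_toSet.infinite_compl
    exact Set.infinite_coe_iff.2 this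
  obtain ⟨g⟩ := nonempty_equiv_of_countable
    (α := ((D'ᶜ : Set W) × ℕ) ⊕ (((σ' '' D')ᶜ : Set W) × ℕ)) (β := {j // j ∉ F})
  let E : ChainSpace D' σ' ≃ ι := ((Equiv.refl W).sumCongr g).trans (Equiv.sumCompl (· ∈ F))
  have hE : ∀ w : W, E (.inl w) = w.1 := fun w => rfl
  let P : Equiv.Perm (ChainSpace D' σ') := Equiv.ofBijective _ (chainMap_bijective hσ')
  -- Forward half-lines start above every value of `h` on `F`, and backward ones run through the
  -- negative integers up to `-1`.
  let B : ℕ := F.sup h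
  let H : ChainSpace D' σ' → ℤ := fun y => match y with
    | .inl w => h w.1
    | .inr (.inl (_, n)) => B + 1 + n
    | .inr (.inr (_, n)) => -1 - n
  have hH : ∀ y, H y < H (P y) := by
    rintro (w | ⟨w, n⟩ | ⟨c, _ | n⟩)
    · by_cases hw : w.1 ∈ D
      · have h1 : P (.inl w) = .inl (σ' w) := dif_pos hw
        rw [h1]
        have h2 := hh w.1 hw
        rw [← hσ'_val w hw] at h2
        change (h w.1 : ℤ) < h (σ' w).1
        exact_mod_cast h2
      · have h1 : P (.inl w) = .inr (.inl (⟨w, hw⟩, 0)) := dif_neg hw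
        rw [h1]
        have h2 : h w.1 ≤ B := Finset.le_sup w.2
        change (h w.1 : ℤ) < B + 1 + (0 : ℕ)
        omega
    · change (B + 1 + n : ℤ) < B + 1 + (n + 1 : ℕ)
      push_cast
      linarith
    · change (-1 - (0 : ℕ) : ℤ) < h c.1.1
      omega
    · change (-1 - (n + 1 : ℕ) : ℤ) < -1 - n
      push_cast
      linarith
  refine ⟨(E.symm.trans P).trans E, fun j hj => ?_, fun j => H (E.symm j), fun j => ?_⟩
  · have hjF : j ∈ F := Finset.mem_insert_of_mem (Finset.mem_union_left _ hj)
    have h1 : E.symm j = .inl ⟨j, hjF⟩ := by rw [Equiv.symm_apply_eq, hE]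
    have h2 : P (.inl ⟨j, hjF⟩) = .inl (σ' ⟨j, hjF⟩) := dif_pos hj
    simp only [Equiv.trans_apply, h1, h2, hE]
    exact hσ'_val ⟨j, hjF⟩ hj
  · simp only [Equiv.trans_apply, Equiv.symm_apply_apply]
    exact hH _

end AcyclicExtension

/-! ### Permutations of the cells of a uniform grid -/

section Cells

/-- The cell of index `k` in the partition of the line into intervals of length `1 / p`. -/
def cell (p : ℕ) (k : ℤ) : Set ℝ := {x | ⌊(p : ℝ) * x⌋ = k}

theorem measurable_floor_mul (p : ℕ) : Measurable fun x : ℝ => ⌊(p : ℝ) * x⌋ :=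
  Int.measurable_floor.comp (measurable_const.mul measurable_id)

theorem measurableSet_cell (p : ℕ) (k : ℤ) : MeasurableSet (cell p k) :=
  measurable_floor_mul p (measurableSet_singleton k)

theorem pairwise_disjoint_cell (p : ℕ) : Pairwise (Function.onFun Disjoint (cell p)) :=
  fun _ _ hkl => Set.disjoint_left.2 fun _ hx hy => hkl (hx.symm.trans hy)

theorem iUnion_cell (p : ℕ) : ⋃ k, cell p k = Set.univ :=
  Set.eq_univ_of_forall fun x => Set.mem_iUnion.2 ⟨⌊(p : ℝ) * x⌋, rfl⟩

theorem volume_cell {p : ℕ} (hp : 0 < p) (k : ℤ) : volume (cell p k) = (p : ℝ≥0∞)⁻¹ := by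
  have hp' : (0 : ℝ) < p := by exact_mod_cast hp
  have h : cell p k = Set.Ico ((k : ℝ) / p) ((k + 1 : ℝ) / p) := by
    ext x
    change ⌊(p : ℝ) * x⌋ = k ↔ _
    rw [Int.floor_eq_iff, Set.mem_Ico, div_le_iff₀ hp', lt_div_iff₀ hp', mul_comm]
  rw [h, Real.volume_Ico, ← sub_div, add_sub_cancel_left, one_div, ENNReal.ofReal_inv_of_pos hp',
    ENNReal.ofReal_natCast]

theorem cell_mul_subset {p q : ℕ} (hq : 0 < q) (k : ℤ) : cell (p * q) k ⊆ cell p (k / q) := by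
  intro x hx
  have hx' : ⌊((p * q : ℕ) : ℝ) * x⌋ = k := hx
  have hq' : (q : ℝ) ≠ 0 := by exact_mod_cast hq.ne'
  change ⌊(p : ℝ) * x⌋ = k / q
  rw [← hx', ← Int.floor_div_natCast]
  congr 1
  push_cast
  field_simp

/-- The map that permutes the cells of the grid of mesh `1 / p` by translations. -/
noncomputable def cellMap (p : ℕ) (e : Equiv.Perm ℤ) (x : ℝ) : ℝ :=
  x + ((e ⌊(p : ℝ) * x⌋ - ⌊(p : ℝ) * x⌋ : ℤ) : ℝ) / p

theorem floor_mul_cellMap {p : ℕ} (hp : 0 < p) (e : Equiv.Perm ℤ) (x : ℝ) :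
    ⌊(p : ℝ) * cellMap p e x⌋ = e ⌊(p : ℝ) * x⌋ := by
  have hp' : (p : ℝ) ≠ 0 := by exact_mod_cast hp.ne'
  rw [cellMap, mul_add, mul_div_cancel₀ _ hp', Int.floor_add_intCast, add_sub_cancel]

theorem cellMap_symm_cellMap {p : ℕ} (hp : 0 < p) (e : Equiv.Perm ℤ) (x : ℝ) :
    cellMap p e.symm (cellMap p e x) = x := by
  rw [cellMap, floor_mul_cellMap hp, e.symm_apply_apply, cellMap]
  push_cast
  ring

theorem measurable_cellMap (p : ℕ) (e : Equiv.Perm ℤ) : Measurable (cellMap p e) := by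
  have h : Measurable fun k : ℤ => ((e k - k : ℤ) : ℝ) / p := measurable_of_countable _
  exact measurable_id.add (h.comp (measurable_floor_mul p))

/-- On each cell the map is a translation onto another cell, and `e` only reindexes the sum over
cells. -/
theorem measurePreserving_cellMap {p : ℕ} (hp : 0 < p) (e : Equiv.Perm ℤ) :
    MeasurePreserving (cellMap p e) volume volume := by
  refine ⟨measurable_cellMap p e, Measure.ext fun A hA => ?_⟩
  have hsum : ∀ B : Set ℝ, MeasurableSet B → volume B = ∑' k, volume (B ∩ cell p k) :=
    fun B hB => by
      rw [← measure_iUnion (fun k l hkl => (pairwise_disjoint_cell p hkl).mono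
        Set.inter_subset_right Set.inter_subset_right)
        fun k => hB.inter (measurableSet_cell p k), ← Set.inter_iUnion, iUnion_cell,
        Set.inter_univ]
  rw [Measure.map_apply (measurable_cellMap p e) hA, hsum _ (measurable_cellMap p e hA), hsum A hA,
    ← e.tsum_eq fun k => volume (A ∩ cell p k)]
  refine tsum_congr fun k => ?_
  rw [← measure_preimage_add_right volume (((e k - k : ℤ) : ℝ) / p) (A ∩ cell p (e k))]
  congr 1
  ext x
  have hp' : (p : ℝ) ≠ 0 := by exact_mod_cast hp.ne'
  have hfloor : ⌊(p : ℝ) * (x + ((e k - k : ℤ) : ℝ) / p)⌋ = ⌊(p : ℝ) * x⌋ + (e k - k) := by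
    rw [mul_add, mul_div_cancel₀ _ hp', Int.floor_add_intCast]
  change (cellMap p e x ∈ A ∧ ⌊(p : ℝ) * x⌋ = k) ↔
    (x + ((e k - k : ℤ) : ℝ) / p ∈ A ∧ ⌊(p : ℝ) * (x + ((e k - k : ℤ) : ℝ) / p)⌋ = e k)
  rw [hfloor]
  constructor
  · rintro ⟨h1, h2⟩
    rw [cellMap, h2] at h1
    exact ⟨h1, by rw [h2]; ring⟩
  · rintro ⟨h1, h2⟩
    have h3 : ⌊(p : ℝ) * x⌋ = k := by linarith
    exact ⟨by rw [cellMap, h3]; exact h1, h3⟩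

/-- The transformation of the line that permutes the cells of the grid of mesh `1 / p`. -/
noncomputable def cellPerm {p : ℕ} (hp : 0 < p) (e : Equiv.Perm ℤ) :
    MPAut (volume : Measure ℝ) where
  toEquiv :=
    { toFun := cellMap p e
      invFun := cellMap p e.symm
      left_inv := cellMap_symm_cellMap hp e
      right_inv := fun x => by simpa using cellMap_symm_cellMap hp e.symm x
      measurable_toFun := measurable_cellMap p e
      measurable_invFun := measurable_cellMap p e.symm }
  measurePreserving := measurePreserving_cellMap hp e

theorem cellPerm_mem_cell {p : ℕ} (hp : 0 < p) (e : Equiv.Perm ℤ) {x : ℝ} {k : ℤ}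
    (hx : x ∈ cell p k) : cellPerm hp e x ∈ cell p (e k) := by
  have h := floor_mul_cellMap hp e x
  rw [show ⌊(p : ℝ) * x⌋ = k from hx] at h
  exact h

theorem iterate_cellPerm_mem_cell {p : ℕ} (hp : 0 < p) (e : Equiv.Perm ℤ) {x : ℝ} {k : ℤ}
    (hx : x ∈ cell p k) (n : ℕ) : (cellPerm hp e)^[n] x ∈ cell p (e^[n] k) := by
  induction n with
  | zero => exact hx
  | succ n ih =>
    rw [Function.iterate_succ_apply', Function.iterate_succ_apply']
    exact cellPerm_mem_cell hp e ih

end Cells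

/-! ### Transformations with wandering cells -/

theorem hasLogNegligibleSums_of_tsum_ne_top {X : Type*} [MeasurableSpace X] {m : Measure X}
    {T : X → X} (h : ∀ f : X → ℝ, Integrable f m → ∀ᵐ x ∂m, ∑' n : ℕ, ‖f (T^[n] x)‖ₑ ≠ ∞) :
    HasLogNegligibleSums T m := by
  refine ⟨id, tendsto_id, fun f hf => ?_⟩
  filter_upwards [h f hf] with x hx
  have hsum : Summable fun n : ℕ => ‖f (T^[n] x)‖ := by
    have := ENNReal.summable_toReal hx
    simpa using this
  have h1 : Tendsto (fun n : ℕ => birkhoffSum T f n x) atTop (𝓝 (∑' n, f (T^[n] x))) :=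
    hsum.of_norm.hasSum.tendsto_sum_nat
  exact h1.div_atTop (Real.tendsto_log_atTop.comp tendsto_natCast_atTop_atTop)

/-- The increasing potential makes the cells `e^n k` distinct, so the integrals of `|f ∘ S^n|` over
cell `k` add up to at most `‖f‖₁`. -/
theorem hasLogNegligibleSums_cellPerm {p : ℕ} (hp : 0 < p) (e : Equiv.Perm ℤ) {H : ℤ → ℤ}
    (hH : ∀ k, H k < H (e k)) : HasLogNegligibleSums (cellPerm hp e) volume := by
  refine hasLogNegligibleSums_of_tsum_ne_top fun f hf => ?_
  have hinj : ∀ k, Function.Injective fun n : ℕ => e^[n] k := fun k => by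
    have hmono : StrictMono fun n : ℕ => H (e^[n] k) := strictMono_nat_of_lt_succ fun n => by
      rw [Function.iterate_succ_apply']
      exact hH _
    exact fun n l hnl => hmono.injective (congrArg H hnl)
  have hSn := fun n : ℕ => (cellPerm hp e).measurePreserving.iterate n
  have hfn : ∀ n : ℕ, AEMeasurable (fun x => ‖f ((cellPerm hp e)^[n] x)‖ₑ) volume := fun n =>
    ((hSn n).integrable_comp_of_integrable hf).aestronglyMeasurable.enorm
  have hcell : ∀ k, ∀ᵐ x ∂volume.restrict (cell p k),
      ∑' n : ℕ, ‖f ((cellPerm hp e)^[n] x)‖ₑ ≠ ∞ := by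
    intro k
    have hfin : ∫⁻ x in cell p k, ∑' n : ℕ, ‖f ((cellPerm hp e)^[n] x)‖ₑ ≠ ∞ := by
      rw [lintegral_tsum fun n => (hfn n).restrict]
      have hle : ∀ n : ℕ, ∫⁻ x in cell p k, ‖f ((cellPerm hp e)^[n] x)‖ₑ ≤
          ∫⁻ x in cell p (e^[n] k), ‖f x‖ₑ := fun n => by
        have hemb : MeasurableEmbedding (cellPerm hp e)^[n] :=
          n.rec MeasurableEmbedding.id fun _ ih => ih.comp (cellPerm hp e).toEquiv.measurableEmbedding
        rw [← (hSn n).setLIntegral_comp_preimage_emb hemb (fun x => ‖f x‖ₑ)]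
        exact lintegral_mono_set fun x hx => iterate_cellPerm_mem_cell hp e hx n
      refine ne_top_of_le_ne_top ?_ (ENNReal.tsum_le_tsum hle)
      rw [← lintegral_iUnion (fun n => measurableSet_cell p _)
        ((pairwise_disjoint_cell p).comp_of_injective (hinj k))]
      exact ne_top_of_le_ne_top hf.2.ne (setLIntegral_le_lintegral _ _)
    exact (ae_lt_top' (AEMeasurable.tsum fun n => (hfn n).restrict) hfin).mono fun x hx => hx.ne
  have hall := ae_restrict_iUnion_iff (μ := volume) (cell p)
    (fun x => ∑' n : ℕ, ‖f ((cellPerm hp e)^[n] x)‖ₑ ≠ ∞)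
  rw [iUnion_cell, Measure.restrict_univ] at hall
  exact hall.2 hcell

/-! ### Density -/

section Density

open scoped symmDiff

theorem eventually_cell_subset {K V : Set ℝ} (hK : IsCompact K) (hV : IsOpen V) (hKV : K ⊆ V) :
    ∀ᶠ p : ℕ in atTop, ∀ x ∈ K, cell p ⌊(p : ℝ) * x⌋ ⊆ V := by
  obtain ⟨δ, hδ, hsub⟩ := hK.exists_thickening_subset_open hV hKV
  filter_upwards [tendsto_natCast_atTop_atTop.eventually_gt_atTop (1 / δ)] with p hp x hx y hy
  refine hsub (Metric.mem_thickening_iff.2 ⟨x, hx, ?_⟩)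
  have hp0 : (0 : ℝ) < p := lt_trans (by positivity) hp
  have h1 : |(p : ℝ) * y - p * x| < 1 := Int.abs_sub_lt_one_of_floor_eq_floor hy
  rw [← mul_sub, abs_mul, abs_of_pos hp0] at h1
  rw [div_lt_iff₀ hδ] at hp
  rw [Real.dist_eq]
  exact lt_of_mul_lt_mul_left (h1.trans hp) hp0.le

theorem IsCompact.finite_image_floor {K : Set ℝ} (hK : IsCompact K) (p : ℕ) :
    ((fun x : ℝ => ⌊(p : ℝ) * x⌋) '' K).Finite := by
  obtain ⟨R, hR⟩ := hK.isBounded.subset_closedBall 0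
  refine (Set.finite_Icc ⌊(p : ℝ) * (-R)⌋ ⌊(p : ℝ) * R⌋).subset ?_
  rintro _ ⟨x, hx, rfl⟩
  have h := abs_le.1 (by simpa using hR hx)
  exact ⟨Int.floor_le_floor (mul_le_mul_of_nonneg_left h.1 p.cast_nonneg),
    Int.floor_le_floor (mul_le_mul_of_nonneg_left h.2 p.cast_nonneg)⟩

theorem Finset.exists_mapsTo_injOn_of_card_le {α β : Type*} [Nonempty β] {s : Finset α}
    {t : Finset β} (h : s.card ≤ t.card) :
    ∃ f : α → β, (∀ a ∈ s, f a ∈ t) ∧ Set.InjOn f s := by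
  classical
  obtain ⟨g⟩ := Function.Embedding.nonempty_of_card_le (α := s) (β := t) (by simpa using h)
  refine ⟨fun a => if ha : a ∈ s then g ⟨a, ha⟩ else Classical.arbitrary β, fun a ha => ?_,
    fun a ha b hb hab => ?_⟩
  · simp [ha]
  · have ha' : a ∈ s := ha
    have hb' : b ∈ s := hb
    simp only [ha', hb', dif_pos] at hab
    exact congrArg Subtype.val (g.injective (Subtype.ext hab))

/-- A finite partial injection of the cells of a grid is realized, up to a small proportion of each
cell, by a transformation with negligible Birkhoff sums. -/
theorem exists_hasLogNegligibleSums_of_injOn {p q : ℕ} (hp : 0 < p) (hq : 0 < q) (u : Finset ℤ)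
    (σ : ℤ → ℤ) (hσ : Set.InjOn σ u) :
    ∃ S : MPAut (volume : Measure ℝ), HasLogNegligibleSums S volume ∧
      ∀ j ∈ u, ∀ x ∈ cell p j, x ∉ cell (p * q) (j * q + (q - 1)) → S x ∈ cell p (σ j) := by
  have hq0 : (0 : ℤ) < q := by exact_mod_cast hq
  -- Piece `r` of cell `j` goes to piece `r + 1` of cell `σ j`. The residue mod `q` increases and
  -- serves as potential; the last piece, `r = q - 1`, is left out.
  set D : Finset ℤ := (u ×ˢ Finset.Ico (0 : ℤ) (q - 1)).image fun z => z.1 * q + z.2 with hD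
  set τ : ℤ → ℤ := fun i => σ (i / q) * q + (i % q + 1) with hτ
  have hdiv : ∀ j r : ℤ, 0 ≤ r → r < q → (j * q + r) / q = j := fun j r h0 h1 => by
    rw [add_comm, Int.add_mul_ediv_right _ _ hq0.ne', Int.ediv_eq_zero_of_lt h0 h1, zero_add]
  have hmod : ∀ j r : ℤ, 0 ≤ r → r < q → (j * q + r) % q = r := fun j r h0 h1 => by
    rw [add_comm, Int.add_mul_emod_self_right, Int.emod_eq_of_lt h0 h1]
  have hmemD : ∀ i, i ∈ D ↔ i / q ∈ u ∧ i % q < q - 1 := by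
    intro i
    simp only [hD, Finset.mem_image, Finset.mem_product, Finset.mem_Ico, Prod.exists]
    constructor
    · rintro ⟨j, r, ⟨hj, h0, h1⟩, rfl⟩
      rw [hdiv j r h0 (by omega), hmod j r h0 (by omega)]
      exact ⟨hj, h1⟩
    · rintro ⟨h1, h2⟩
      exact ⟨i / q, i % q, ⟨h1, Int.emod_nonneg _ hq0.ne', h2⟩, Int.ediv_mul_add_emod i q⟩
  have hτD : ∀ i ∈ D, τ i / q = σ (i / q) ∧ τ i % q = i % q + 1 := fun i hi => by
    have h0 := Int.emod_nonneg i hq0.ne'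
    have h1 := ((hmemD i).1 hi).2
    exact ⟨hdiv _ _ (by omega) (by omega), hmod _ _ (by omega) (by omega)⟩
  have hinj : Set.InjOn τ D := fun i hi i' hi' heq => by
    have h1 := hτD i hi
    have h2 := hτD i' hi'
    rw [heq] at h1
    have h3 : i / q = i' / q :=
      hσ ((hmemD i).1 hi).1 ((hmemD i').1 hi').1 (h1.1.symm.trans h2.1)
    have h4 : i % q = i' % q := by linarith [h1.2, h2.2]
    rw [← Int.ediv_mul_add_emod i q, ← Int.ediv_mul_add_emod i' q, h3, h4]
  obtain ⟨e, he, H, hH⟩ := exists_perm_extending D τ hinj (fun i => (i % q).toNat) fun i hi => by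
    have h0 := Int.emod_nonneg i hq0.ne'
    rw [(hτD i hi).2]
    omega
  have hpq : 0 < p * q := Nat.mul_pos hp hq
  refine ⟨cellPerm hpq e, hasLogNegligibleSums_cellPerm hpq e hH, fun j hj x hx hx' => ?_⟩
  set i := ⌊((p * q : ℕ) : ℝ) * x⌋ with hi
  have hxi : x ∈ cell (p * q) i := rfl
  have hij : i / q = j := (cell_mul_subset hq i hxi).symm.trans hx
  have hiD : i ∈ D := by
    refine (hmemD i).2 ⟨hij ▸ hj, lt_of_le_of_ne ?_ fun h => hx' ?_⟩
    · have := Int.emod_lt_of_pos i hq0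
      omega
    · rw [← h, ← hij, Int.ediv_mul_add_emod]
      exact hxi
  have h1 := cell_mul_subset hq _ (cellPerm_mem_cell hpq e hxi)
  rw [he i hiD, (hτD i hiD).1, hij] at h1
  exact h1

/-- Fine cells meeting a compact part of `T⁻¹(cell a k)` are sent injectively into `cell a k`. The
three errors `η` are the complement of the compact part, the fine cells in excess of the `b`
available places, and the last pieces left out above. -/
theorem exists_hasLogNegligibleSums_approx (T : MPAut (volume : Measure ℝ)) {a : ℕ} (ha : 0 < a)
    (s : Finset ℤ) {η : ℝ≥0∞} (hη : η ≠ 0) :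
    ∃ S : MPAut (volume : Measure ℝ), HasLogNegligibleSums S volume ∧
      ∀ k ∈ s, volume (T ⁻¹' cell a k \ S ⁻¹' cell a k) ≤ η + (η + η) := by
  classical
  have hTm : ∀ k, MeasurableSet (T ⁻¹' cell a k) := fun k =>
    T.toEquiv.measurable (measurableSet_cell a k)
  have hTv : ∀ k, volume (T ⁻¹' cell a k) = (a : ℝ≥0∞)⁻¹ := fun k => by
    rw [T.measurePreserving.measure_preimage (measurableSet_cell a k).nullMeasurableSet,
      volume_cell ha]
  have haR : (a : ℝ≥0∞) ≠ 0 := by exact_mod_cast ha.ne'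
  have hTfin : ∀ k, volume (T ⁻¹' cell a k) ≠ ∞ := fun k => by
    rw [hTv]
    exact ENNReal.inv_ne_top.2 haR
  choose K hKsub hKc hKv using fun k => (hTm k).exists_isCompact_sdiff_lt (hTfin k) hη
  choose V hKV hVo hVv using fun k => (K k).exists_isOpen_le_add volume hη
  have hdisj : ∀ k l, k ≠ l → Disjoint (K k) (K l) := fun k l hkl =>
    ((pairwise_disjoint_cell a hkl).preimage T).mono (hKsub k) (hKsub l)
  -- Avoiding the other compact sets makes the families `t k` of fine cells disjoint.
  set V' : ℤ → Set ℝ := fun k => V k ∩ ⋂ l ∈ s.erase k, (K l)ᶜ with hV'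
  have hV'o : ∀ k, IsOpen (V' k) := fun k =>
    (hVo k).inter (isOpen_biInter_finset fun l _ => (hKc l).isClosed.isOpen_compl)
  have hKV' : ∀ k, K k ⊆ V' k := fun k x hx => ⟨hKV k hx, Set.mem_iInter₂.2 fun l hl hxl =>
    Set.disjoint_left.1 (hdisj k l (Finset.ne_of_mem_erase hl).symm) hx hxl⟩
  have hev : ∀ᶠ p : ℕ in atTop, ∀ k ∈ s, ∀ x ∈ K k, cell p ⌊(p : ℝ) * x⌋ ⊆ V' k :=
    (eventually_all_finset s).2 fun k _ => eventually_cell_subset (hKc k) (hV'o k) (hKV' k)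
  have hmul : Tendsto (fun b : ℕ => a * b) atTop atTop :=
    tendsto_id.const_mul_atTop' ha
  obtain ⟨b, hb, hb0⟩ := ((hmul.eventually hev).and (eventually_gt_atTop 0)).exists
  set p := a * b with hp
  have hp0 : 0 < p := Nat.mul_pos ha hb0
  have hpR : (p : ℝ≥0∞) ≠ 0 := by exact_mod_cast hp0.ne'
  have hb0' : (0 : ℤ) < b := by exact_mod_cast hb0
  set t : ℤ → Finset ℤ := fun k => ((hKc k).finite_image_floor p).toFinset with ht
  have hmemt : ∀ k j, j ∈ t k ↔ ∃ x ∈ K k, ⌊(p : ℝ) * x⌋ = j := fun k j => by simp [ht]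
  have htV : ∀ k ∈ s, ∀ j ∈ t k, cell p j ⊆ V' k := fun k hk j hj => by
    obtain ⟨x, hx, rfl⟩ := (hmemt k j).1 hj
    exact hb k hk x hx
  have htdisj : ∀ k ∈ s, ∀ l ∈ s, ∀ j, j ∈ t k → j ∈ t l → k = l := fun k hk l hl j hjk hjl => by
    by_contra hkl
    obtain ⟨x, hx, hxj⟩ := (hmemt l j).1 hjl
    have h1 := (htV k hk j hjk hxj).2
    exact Set.mem_iInter₂.1 h1 l (Finset.mem_erase.2 ⟨Ne.symm hkl, hl⟩) hx
  have hvol : ∀ w : Finset ℤ, volume (⋃ j ∈ w, cell p j) = w.card * (p : ℝ≥0∞)⁻¹ := fun w => by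
    rw [measure_biUnion_finset (fun i _ j _ hij => pairwise_disjoint_cell p hij)
      fun j _ => measurableSet_cell p j]
    simp [volume_cell hp0]
  have hbp : (b : ℝ≥0∞) * (p : ℝ≥0∞)⁻¹ = (a : ℝ≥0∞)⁻¹ := by
    have hbR : (b : ℝ≥0∞) ≠ 0 := by exact_mod_cast hb0.ne'
    rw [hp, Nat.cast_mul, ENNReal.mul_inv (Or.inl haR) (Or.inl (ENNReal.natCast_ne_top a)), mul_comm,
      mul_assoc, ENNReal.inv_mul_cancel hbR (ENNReal.natCast_ne_top b), mul_one]
  -- The cells of `t k` have total measure at most `1/a + η`, while `b` fine cells have measure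
  -- exactly `1/a`.
  have hcard : ∀ k ∈ s, ((t k).card - b : ℕ) * (p : ℝ≥0∞)⁻¹ ≤ η := fun k hk => by
    have h1 : (t k).card * (p : ℝ≥0∞)⁻¹ ≤ (a : ℝ≥0∞)⁻¹ + η := by
      rw [← hvol]
      calc volume (⋃ j ∈ t k, cell p j) ≤ volume (V k) :=
            measure_mono (Set.iUnion₂_subset fun j hj => (htV k hk j hj).trans Set.inter_subset_left)
        _ ≤ volume (K k) + η := hVv k
        _ ≤ (a : ℝ≥0∞)⁻¹ + η := by
            gcongr
            exact (measure_mono (hKsub k)).trans (hTv k).le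
    rw [ENNReal.natCast_sub, ENNReal.sub_mul fun _ _ => ENNReal.inv_ne_top.2 hpR, hbp]
    exact tsub_le_iff_left.2 h1
  choose u hut hucard using fun k => Finset.exists_subset_card_eq (min_le_left (t k).card b)
  have hg : ∀ k : ℤ, ∃ g : ℤ → ℤ, (∀ j ∈ u k, g j ∈ Finset.Ico (k * b) (k * b + b)) ∧
      Set.InjOn g (u k) := fun k => Finset.exists_mapsTo_injOn_of_card_le (by
    rw [hucard, Int.card_Ico, add_sub_cancel_left, Int.toNat_natCast]
    exact min_le_right _ _)
  choose g hgmem hginj using hg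
  -- At most `b` last pieces of measure `1/(p q)` are lost, in all at most `1/(a q) ≤ 1/q < η`.
  obtain ⟨q, hq⟩ := ENNReal.exists_inv_nat_lt hη
  have hq0 : 0 < q := Nat.pos_of_ne_zero fun h => by simp [h] at hq
  set c : ℤ → ℤ := fun j => if h : ∃ k ∈ s, j ∈ u k then h.choose else 0 with hc
  have hcu : ∀ k ∈ s, ∀ j ∈ u k, c j = k := fun k hk j hj => by
    have h : ∃ k ∈ s, j ∈ u k := ⟨k, hk, hj⟩
    have h1 := h.choose_spec
    have h2 : c j = h.choose := dif_pos h
    rw [h2]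
    exact htdisj _ h1.1 k hk j (hut _ h1.2) (hut k hj)
  set σ : ℤ → ℤ := fun j => g (c j) j with hσ
  have hσdiv : ∀ k ∈ s, ∀ j ∈ u k, σ j / b = k := fun k hk j hj => by
    have h := Finset.mem_Ico.1 (hgmem k j hj)
    simp only [hσ, hcu k hk j hj]
    refine (Int.ediv_eq_iff_of_pos hb0').2 ⟨h.1, ?_⟩
    linarith [h.2]
  have hσinj : Set.InjOn σ (s.biUnion u) := fun j hj j' hj' heq => by
    obtain ⟨k, hk, hjk⟩ := Finset.mem_biUnion.1 hj
    obtain ⟨k', hk', hjk'⟩ := Finset.mem_biUnion.1 hj'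
    have h1 := hσdiv k hk j hjk
    rw [heq, hσdiv k' hk' j' hjk'] at h1
    subst h1
    simp only [hσ, hcu k' hk' j hjk, hcu k' hk' j' hjk'] at heq
    exact hginj k' hjk hjk' heq
  obtain ⟨S, hS, hSu⟩ := exists_hasLogNegligibleSums_of_injOn hp0 hq0 (s.biUnion u) σ hσinj
  refine ⟨S, hS, fun k hk => ?_⟩
  have hsub : T ⁻¹' cell a k \ S ⁻¹' cell a k ⊆ (T ⁻¹' cell a k \ K k) ∪
      ((⋃ j ∈ t k \ u k, cell p j) ∪ ⋃ j ∈ u k, cell (p * q) (j * q + (q - 1))) := by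
    rintro x ⟨hxT, hxS⟩
    by_cases hxK : x ∈ K k
    · right
      set j := ⌊(p : ℝ) * x⌋ with hj
      have hjt : j ∈ t k := (hmemt k j).2 ⟨x, hxK, rfl⟩
      by_cases hju : j ∈ u k
      · right
        refine Set.mem_iUnion₂.2 ⟨j, hju, ?_⟩
        by_contra hx
        have h1 := hSu j (Finset.mem_biUnion.2 ⟨k, hk, hju⟩) x rfl hx
        have h2 := cell_mul_subset hb0 _ h1
        rw [hσdiv k hk j hju] at h2
        exact hxS h2
      · left
        exact Set.mem_iUnion₂.2 ⟨j, Finset.mem_sdiff.2 ⟨hjt, hju⟩, rfl⟩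
    · exact Or.inl ⟨hxT, hxK⟩
  refine (measure_mono hsub).trans ((measure_union_le _ _).trans (add_le_add (hKv k).le
    ((measure_union_le _ _).trans (add_le_add ?_ ?_))))
  · rw [hvol, Finset.card_sdiff_of_subset (hut k), hucard,
      show (t k).card - min (t k).card b = (t k).card - b by omega]
    exact hcard k hk
  · refine (measure_biUnion_finset_le _ _).trans ?_
    simp only [volume_cell (Nat.mul_pos hp0 hq0), Finset.sum_const, nsmul_eq_mul, hucard]
    have hqR : (q : ℝ≥0∞) ≠ 0 := by exact_mod_cast hq0.ne'
    rw [Nat.cast_mul, ENNReal.mul_inv (Or.inl hpR) (Or.inl (ENNReal.natCast_ne_top p)), ← mul_assoc]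
    refine le_trans (mul_le_of_le_one_left bot_le ?_) hq.le
    calc ((min (t k).card b : ℕ) : ℝ≥0∞) * (p : ℝ≥0∞)⁻¹ ≤ (b : ℝ≥0∞) * (p : ℝ≥0∞)⁻¹ := by
          gcongr
          exact min_le_right _ _
      _ = (a : ℝ≥0∞)⁻¹ := hbp
      _ ≤ 1 := ENNReal.inv_le_one.2 (by exact_mod_cast ha)

/-- `S⁻¹ D` and `T⁻¹ D` have the same finite measure, so their two one-sided differences do too, and
bounding one suffices. -/
theorem MPAut.measure_preimage_symmDiff_le {X : Type*} [MeasurableSpace X] {m : Measure X}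
    (S T : MPAut m) {A D : Set X} (hA : MeasurableSet A) (hD : MeasurableSet D) (hfin : m D ≠ ∞) :
    m ((S ⁻¹' A) ∆ (T ⁻¹' A)) ≤ 2 * m (A ∆ D) + 2 * m (T ⁻¹' D \ S ⁻¹' D) := by
  have hpre : ∀ (R : MPAut m) {B : Set X}, MeasurableSet B → m (R ⁻¹' B) = m B := fun R B hB =>
    R.measurePreserving.measure_preimage hB.nullMeasurableSet
  have hSD := (S.toEquiv.measurable hD).nullMeasurableSet (μ := m)
  have hTD := (T.toEquiv.measurable hD).nullMeasurableSet (μ := m)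
  have h1 : m (S ⁻¹' D \ T ⁻¹' D) = m (T ⁻¹' D \ S ⁻¹' D) :=
    measure_sdiff_symm hSD hTD ((hpre S hD).trans (hpre T hD).symm)
      (ne_top_of_le_ne_top hfin ((measure_mono Set.inter_subset_left).trans (hpre S hD).le))
  have h2 : m ((S ⁻¹' A) ∆ (S ⁻¹' D)) = m (A ∆ D) := hpre S (hA.symmDiff hD)
  have h3 : m ((T ⁻¹' D) ∆ (T ⁻¹' A)) = m (A ∆ D) := by
    rw [symmDiff_comm]
    exact hpre T (hA.symmDiff hD)
  have h4 : m ((S ⁻¹' D) ∆ (T ⁻¹' D)) ≤ 2 * m (T ⁻¹' D \ S ⁻¹' D) := by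
    rw [two_mul]
    exact (measure_union_le _ _).trans (add_le_add h1.le le_rfl)
  calc m ((S ⁻¹' A) ∆ (T ⁻¹' A))
      ≤ m ((S ⁻¹' A) ∆ (S ⁻¹' D)) + (m ((S ⁻¹' D) ∆ (T ⁻¹' D)) + m ((T ⁻¹' D) ∆ (T ⁻¹' A))) :=
        (measure_symmDiff_le _ _ _).trans (add_le_add le_rfl (measure_symmDiff_le _ _ _))
    _ ≤ m (A ∆ D) + (2 * m (T ⁻¹' D \ S ⁻¹' D) + m (A ∆ D)) := by
        rw [h2, h3]
        gcongr
    _ = 2 * m (A ∆ D) + 2 * m (T ⁻¹' D \ S ⁻¹' D) := by ring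

theorem eventually_exists_cells_approx {A : Set ℝ} (hA : MeasurableSet A) (hfin : volume A ≠ ∞)
    {ε : ℝ≥0∞} (hε : ε ≠ 0) : ∀ᶠ n : ℕ in atTop,
      ∃ t ⊆ Finset.Icc (-((n : ℤ) ^ 2)) ((n : ℤ) ^ 2),
        volume (A ∆ ⋃ k ∈ t, cell n k) ≤ ε + ε := by
  classical
  obtain ⟨K, hKA, hKc, hKv⟩ := hA.exists_isCompact_sdiff_lt hfin hε
  obtain ⟨V, hKV, hVo, -, hVv⟩ := hKc.measurableSet.exists_isOpen_sdiff_lt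
    (ne_top_of_le_ne_top hfin (measure_mono hKA)) hε
  obtain ⟨R, hR⟩ := hKc.isBounded.subset_closedBall 0
  filter_upwards [eventually_cell_subset hKc hVo hKV,
    tendsto_natCast_atTop_atTop.eventually_ge_atTop R] with n hn hnR
  refine ⟨(hKc.finite_image_floor n).toFinset, ?_, ?_⟩
  · intro k hk
    obtain ⟨x, hx, rfl⟩ := (Set.Finite.mem_toFinset _).1 hk
    -- For `|x| ≤ R ≤ n` the index `⌊n x⌋` lies between `-n²` and `n²`.
    have h := abs_le.1 ((show |x| ≤ R by simpa using hR hx).trans hnR)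
    have hn0 : (0 : ℝ) ≤ n := n.cast_nonneg
    refine Finset.mem_Icc.2 ⟨Int.le_floor.2 ?_, Int.floor_le_iff.2 ?_⟩
    · push_cast
      nlinarith
    · push_cast
      nlinarith
  · have hsub : A ∆ (⋃ k ∈ (hKc.finite_image_floor n).toFinset, cell n k) ⊆ (A \ K) ∪ (V \ K) := by
      rintro x (⟨hxA, hx⟩ | ⟨hx, hxA⟩)
      · refine Or.inl ⟨hxA, fun hxK => hx (Set.mem_iUnion₂.2 ⟨⌊(n : ℝ) * x⌋, ?_, rfl⟩)⟩
        exact (Set.Finite.mem_toFinset _).2 ⟨x, hxK, rfl⟩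
      · obtain ⟨k, hk, hxk⟩ := Set.mem_iUnion₂.1 hx
        obtain ⟨y, hy, rfl⟩ := (Set.Finite.mem_toFinset _).1 hk
        exact Or.inr ⟨hn y hy hxk, fun hxK => hxA (hKA hxK)⟩
    exact (measure_mono hsub).trans ((measure_union_le _ _).trans (add_le_add hKv.le hVv.le))

/-- One sequence works for all `A` at once: `S n` imitates `T` on all cells of mesh `1/n` with index
in `[-n², n²]` with total error `3 δ n → 0`, and unions of such cells approximate every `A` of
finite measure. -/
theorem MPAut.dense_hasLogNegligibleSums :
    Dense {T : MPAut (volume : Measure ℝ) | _root_.HasLogNegligibleSums T volume} := by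
  intro T
  set s : ℕ → Finset ℤ := fun n => Finset.Icc (-((n : ℤ) ^ 2)) ((n : ℤ) ^ 2) with hs
  set δ : ℕ → ℝ≥0∞ := fun n => ((n : ℝ≥0∞) + 1)⁻¹ with hδ
  have hδ0 : ∀ n, δ n ≠ 0 := fun n => ENNReal.inv_ne_zero.2 (by finiteness)
  have hS : ∀ n : ℕ, ∃ S : MPAut (volume : Measure ℝ), _root_.HasLogNegligibleSums S volume ∧
      (0 < n → ∑ k ∈ s n, volume (T ⁻¹' cell n k \ S ⁻¹' cell n k) ≤ 3 * δ n) := by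
    intro n
    have hcard : ((s n).card : ℝ≥0∞) ≠ 0 := by
      have h : 0 < (s n).card := Finset.card_pos.2 ⟨0, Finset.mem_Icc.2 ⟨by
        have := sq_nonneg (n : ℤ)
        linarith, sq_nonneg _⟩⟩
      exact_mod_cast h.ne'
    rcases Nat.eq_zero_or_pos n with rfl | hn
    · obtain ⟨S, hS, -⟩ := exists_hasLogNegligibleSums_approx T one_pos ∅ one_ne_zero
      exact ⟨S, hS, fun h => absurd h (lt_irrefl 0)⟩
    · obtain ⟨S, hS, hle⟩ := exists_hasLogNegligibleSums_approx T hn (s n)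
        (η := δ n / (s n).card) (ENNReal.div_pos (hδ0 n) (ENNReal.natCast_ne_top _)).ne'
      refine ⟨S, hS, fun _ => (Finset.sum_le_sum hle).trans (le_of_eq ?_)⟩
      rw [Finset.sum_const, nsmul_eq_mul, mul_add, mul_add,
        ENNReal.mul_div_cancel hcard (ENNReal.natCast_ne_top _)]
      ring
  choose S hSG hSs using hS
  refine mem_closure_of_tendsto (MPAut.tendsto_iff.2 fun A hA hfin => ?_)
    (Eventually.of_forall hSG : ∀ᶠ n in atTop, S n ∈ _)
  refine ENNReal.tendsto_nhds_zero.2 fun ε hε => ?_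
  have hδt : Tendsto (fun n => 6 * δ n) atTop (𝓝 0) := by
    have h := ENNReal.Tendsto.const_mul (a := 6)
      ((tendsto_add_atTop_iff_nat 1).2 ENNReal.tendsto_inv_nat_nhds_zero) (Or.inr (by norm_num))
    simpa [hδ] using h
  -- Approximating `A` by cells to within `ε/8 + ε/8`, counted twice, costs `ε/2`; the other half
  -- bounds `6 δ n`.
  have hε' : ε / 8 ≠ 0 := (ENNReal.div_pos hε.ne' (by norm_num)).ne'
  have hε2 : 0 < ε / 2 := ENNReal.half_pos hε.ne'
  filter_upwards [eventually_exists_cells_approx hA hfin.ne hε', eventually_gt_atTop 0,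
    ENNReal.tendsto_nhds_zero.1 hδt _ hε2] with n ⟨t, hts, htA⟩ hn hδn
  set D : Set ℝ := ⋃ k ∈ t, cell n k with hD
  have hDm : MeasurableSet D := Finset.measurableSet_biUnion _ fun k _ => measurableSet_cell n k
  have hDfin : volume D ≠ ∞ := by
    refine ne_top_of_le_ne_top ?_ (measure_biUnion_finset_le _ _)
    refine ENNReal.sum_ne_top.2 fun k _ => ?_
    rw [volume_cell hn]
    exact ENNReal.inv_ne_top.2 (by exact_mod_cast hn.ne')
  have hdiff : volume (T ⁻¹' D \ S n ⁻¹' D) ≤ 3 * δ n := by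
    have hsub : T ⁻¹' D \ S n ⁻¹' D ⊆ ⋃ k ∈ t, (T ⁻¹' cell n k \ S n ⁻¹' cell n k) := by
      rintro x ⟨hxT, hxS⟩
      obtain ⟨k, hk, hxk⟩ := Set.mem_iUnion₂.1 hxT
      exact Set.mem_iUnion₂.2 ⟨k, hk, hxk, fun h => hxS (Set.mem_iUnion₂.2 ⟨k, hk, h⟩)⟩
    exact (measure_mono hsub).trans ((measure_biUnion_finset_le _ _).trans
      ((Finset.sum_le_sum_of_subset hts).trans (hSs n hn)))
  calc volume ((S n ⁻¹' A) ∆ (T ⁻¹' A))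
      ≤ 2 * volume (A ∆ D) + 2 * volume (T ⁻¹' D \ S n ⁻¹' D) :=
        MPAut.measure_preimage_symmDiff_le (S n) T hA hDm hDfin
    _ ≤ 2 * (ε / 8 + ε / 8) + 2 * (3 * δ n) := by gcongr
    _ = 4 * (ε / 8) + 6 * δ n := by ring
    _ ≤ ε / 2 + ε / 2 := by
        refine add_le_add (le_of_eq ?_) hδn
        rw [show (8 : ℝ≥0∞) = 4 * 2 by norm_num, div_eq_mul_inv, div_eq_mul_inv,
          ENNReal.mul_inv (by norm_num) (by norm_num), mul_left_comm, ← mul_assoc 4,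
          ENNReal.mul_inv_cancel (by norm_num) (by norm_num), one_mul]
    _ = ε := ENNReal.add_halves ε

theorem MPGroup.dense_hasLogNegligibleSums :
    Dense {T : MPGroup (volume : Measure ℝ) | T.HasLogNegligibleSums} := by
  have hcont : Continuous (QuotientGroup.mk : MPAut (volume : Measure ℝ) → MPGroup volume) :=
    continuous_quotient_mk'
  have hrange : DenseRange (QuotientGroup.mk : MPAut (volume : Measure ℝ) → MPGroup volume) :=
    QuotientGroup.mk_surjective.denseRange
  refine (hrange.dense_image hcont MPAut.dense_hasLogNegligibleSums).mono ?_
  rintro _ ⟨S, hS, rfl⟩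
  exact hS

theorem MPGroup.HasLogNegligibleSums.not_isLLB {X : Type*} [MeasurableSpace X] {m : Measure X}
    {T : MPGroup m} (hT : T.HasLogNegligibleSums) : ¬ T.IsLLB := by
  induction T using Quotient.inductionOn with
  | h S => exact _root_.HasLogNegligibleSums.not_logLowerBounded hT

end Density

theorem proposition3p4 :
    IsMeagre {T : MPGroup (volume : Measure ℝ) | T.IsLLB} ∧
    IsGδ {T : MPGroup (volume : Measure ℝ) | T.HasLogNegligibleSums} ∧
    Dense {T : MPGroup (volume : Measure ℝ) | T.HasLogNegligibleSums} ∧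
    {T : MPGroup (volume : Measure ℝ) | T.HasLogNegligibleSums} ⊆
      {T : MPGroup (volume : Measure ℝ) | T.IsLLB}ᶜ := by
  have hGδ := MPGroup.isGδ_hasLogNegligibleSums (m := (volume : Measure ℝ))
  have hdense := MPGroup.dense_hasLogNegligibleSums
  have hsub : {T : MPGroup (volume : Measure ℝ) | T.HasLogNegligibleSums} ⊆
      {T : MPGroup (volume : Measure ℝ) | T.IsLLB}ᶜ := fun T hT => hT.not_isLLB
  exact ⟨mem_of_superset (residual_of_dense_Gδ hGδ hdense) hsub, hGδ, hdense, hsub⟩
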